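/- Conventions. A well-quasi-ordering (WQO) is a set $X$ with a reflexive transitive relation $\le$ such that every infinite sequence $x_0,x_1,\dots$ in $X$ has $i<j$ with $x_i\le x_j$. An ideal is a non-empty, downwards-closed, directed subset; $\mathrm{Idl}(X)$ and $\mathrm{Down}(X)$ denote the sets of ideals and of downwards-closed sets. A data structure for a set $Y$ is a map from a recursive set of codes onto $Y$. Given data structures for $X$ and $\mathrm{Idl}(X)$, upwards-closed sets are represented by finite lists of elements (as finite unions of principal filters $\uparrow x$), and downwards-closed sets by finite lists of ideals (as finite unions). A WQO $(X,\le)$ with such data structures is \emph{ideally effective} if $\le$ on $X$ and $\subseteq$ on $\mathrm{Idl}(X)$ are decidable, and the maps $x\mapsto{\downarrow}x$, $\uparrow x\mapsto X\setminus{\uparrow}x$, $({\uparrow}x,{\uparrow}y)\mapsto{\uparrow}x\cap{\uparrow}y$, $I\mapsto X\setminus I$ and $(I,J)\mapsto I\cap J$ are computable. A \emph{presentation} consists of (deciders for) the data structures, algorithms for these seven operations, and decompositions of $X$ as a finite union of ideals and as a finite union of principal filters. A constructor is \emph{ideally effective} if it maps WQOs to WQOs, maps ideally effective WQOs to ideally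 effective WQOs, and if a presentation of its result is uniformly computable from a presentation of its argument. Let $X^*$ be the set of finite sequences over $X$ (with $\varepsilon$ the empty sequence), $\le_*$ Higman's quasi-ordering on it ($u\le_* v$ iff $v$ has a subsequence of the same length as $u$ that dominates $u$ letterwise), and $\sim$ the equality of sequences up to a permutation of positions. The set $X^\circledast$ of finite multisets over $X$ is $X^*/{\sim}$, quasi-ordered by multiset embedding $\le_{\mathrm{emb}}$, the relation induced by ${\sim}\circ{\le_*}$. An atom is a set $D^*$ with $D\in\mathrm{Down}(X)$, or a set $I+\varepsilon=\{x\mid x\in I\}\cup\{\varepsilon\}$ with $I\in\mathrm{Idl}(X)$. For $L\subseteq X^*$, $\overline L$ is the closure of $L$ under $\sim$. Multisets are represented by lists of elements of $X$, and ideals of $X^\circledast$ by lists of atoms, where $A_1,\dots,A_n$ represents the set of multisets that have a representative in $A_1\cdots A_n$; atoms $I+\varepsilon$ and $D^*$ are represented through $I$, and through a list of ideals with union $D$. Theorem. 1. With these representations, finite multisets with multiset embedding, $(X,\le)\mapsto(X^\circledast,\le_{\mathrm{emb}})$, is an ideally effective constructor. 2. On $X^*$, ${\sim}\circ{\le_*}={\le_*}\circ{\sim}$,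 and this is the relation that $\le_{\mathrm{emb}}$ induces on representatives. 3. Let $(X,\le)$ be a WQO and $P=A_1\cdots A_n$ a product of atoms. Let $D$ be the union of the sets $E$ over all factors of the form $E^*$, and let $I_1,\dots,I_p$ be the ideals in the factors of the form $I+\varepsilon$, with repetitions and in order of occurrence. Then $$\overline{P}=\bigcup_{\sigma\in S_p} D^*\,(I_{\sigma(1)}+\varepsilon)\,D^*\cdots D^*\,(I_{\sigma(p)}+\varepsilon)\,D^* .$$ -/

import Mathlib

universe u

open List (SublistForall₂)

/-! ## Finite multisets with the embedding quasi-ordering -/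

/-- Higman's quasi-ordering on `X*`: `v` has a subsequence that dominates `u` letter by letter. -/
abbrev HigmanLE {X : Type u} [Preorder X] (u v : List X) : Prop :=
  SublistForall₂ (· ≤ ·) u v

theorem higmanLE_iff {X : Type u} [Preorder X] {u v : List X} :
    HigmanLE u v ↔ ∃ l, List.Forall₂ (· ≤ ·) u l ∧ l.Sublist v :=
  List.sublistForall₂_iff

/-- Permutation commutes past Higman's quasi-ordering. -/
theorem HigmanLE.exists_perm {X : Type u} [Preorder X] {u v v' : List X}
    (h : HigmanLE u v) (hp : v.Perm v') : ∃ u' : List X, u.Perm u' ∧ HigmanLE u' v' := by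
  obtain ⟨l, hul, hlv⟩ := higmanLE_iff.1 h
  obtain ⟨l', hl', hlv'⟩ := List.Subperm.trans hlv.subperm hp.subperm
  obtain ⟨u', hu', hul'⟩ : ∃ u', u.Perm u' ∧ List.Forall₂ (· ≤ ·) u' l' := by
    have : Relation.Comp (List.Forall₂ (· ≤ ·)) List.Perm u l' := ⟨l, hul, hl'.symm⟩
    rwa [List.forall₂_comp_perm_eq_perm_comp_forall₂] at this
  exact ⟨u', hu', higmanLE_iff.2 ⟨l', hul', hlv'⟩⟩

/-- Finite multisets over `X` (lists up to permutation), to be ordered by embedding. -/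
def FinMultiset (X : Type u) : Type u := Multiset X

/-- The multiset represented by a list, i.e. its class modulo permutation. -/
def FinMultiset.ofList {X : Type u} (w : List X) : FinMultiset X := (w : Multiset X)

theorem FinMultiset.ofList_eq {X : Type u} {u v : List X} :
    FinMultiset.ofList u = FinMultiset.ofList v ↔ u.Perm v :=
  Multiset.coe_eq_coe

theorem FinMultiset.exists_ofList {X : Type u} (M : FinMultiset X) :
    ∃ w, FinMultiset.ofList w = M :=
  Quotient.exists_rep M

/-- Multiset embedding: some representatives are related by Higman's quasi-ordering. -/
instance FinMultiset.instPreorder (X : Type u) [Preorder X] : Preorder (FinMultiset X) where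
  le M N := ∃ u v : List X, ofList u = M ∧ ofList v = N ∧ HigmanLE u v
  le_refl M := by
    obtain ⟨w, rfl⟩ := M.exists_ofList
    exact ⟨w, w, rfl, rfl, refl w⟩
  le_trans := by
    rintro _ _ _ ⟨u, v, rfl, rfl, h⟩ ⟨v', w, hv, rfl, h'⟩
    obtain ⟨u', hu, hu'⟩ := h.exists_perm (ofList_eq.1 hv).symm
    exact ⟨u', w, ofList_eq.2 hu.symm, rfl, _root_.trans hu' h'⟩

/-! ## Atoms and products of atoms -/

/-- Atoms over `X`: `D*` for `D` downwards-closed, and `I + ε` for `I` an ideal. -/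
inductive Atom (X : Type u) [Preorder X] : Type u
  | star (D : LowerSet X) : Atom X
  | opt (I : Order.Ideal X) : Atom X

/-- The set of sequences denoted by an atom. -/
def Atom.lang {X : Type u} [Preorder X] : Atom X → Language X
  | .star D => {w : List X | ∀ x ∈ w, x ∈ D}
  | .opt I => {w : List X | w = [] ∨ ∃ x ∈ I, w = [x]}

/-- The set of sequences denoted by a product of atoms (product = concatenation). -/
def productLang {X : Type u} [Preorder X] (P : List (Atom X)) : Language X :=
  (P.map Atom.lang).prod

section AtomFacts

variable {X : Type u} [Preorder X]

theorem mem_productLang_nil {w : List X} : w ∈ productLang ([] : List (Atom X)) ↔ w = [] := by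
  simp [productLang]

theorem mem_productLang_cons {A : Atom X} {P : List (Atom X)} {w : List X} :
    w ∈ productLang (A :: P) ↔ ∃ a ∈ A.lang, ∃ b ∈ productLang P, a ++ b = w := by
  simp [productLang, Language.mem_mul]

theorem mem_lang_star {D : LowerSet X} {w : List X} :
    w ∈ (Atom.star D).lang ↔ ∀ x ∈ w, x ∈ D := Iff.rfl

theorem mem_lang_opt {I : Order.Ideal X} {w : List X} :
    w ∈ (Atom.opt I).lang ↔ w = [] ∨ ∃ x ∈ I, w = [x] := Iff.rfl

theorem Atom.nil_mem_lang (A : Atom X) : [] ∈ A.lang := by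
  cases A with
  | star D => simp [mem_lang_star]
  | opt I => simp [mem_lang_opt]

theorem HigmanLE.append {u v u' v' : List X} (h : HigmanLE u v) (h' : HigmanLE u' v') :
    HigmanLE (u ++ u') (v ++ v') := by
  obtain ⟨l, h1, h2⟩ := higmanLE_iff.1 h
  obtain ⟨l', h1', h2'⟩ := higmanLE_iff.1 h'
  exact higmanLE_iff.2 ⟨l ++ l', List.rel_append h1 h1', h2.append h2'⟩

theorem HigmanLE.split {u a b : List X} (h : HigmanLE u (a ++ b)) :
    ∃ c d, u = c ++ d ∧ HigmanLE c a ∧ HigmanLE d b := by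
  obtain ⟨l, h1, h2⟩ := higmanLE_iff.1 h
  obtain ⟨l₁, l₂, rfl, ha, hb⟩ := List.sublist_append_iff.1 h2
  exact ⟨u.take l₁.length, u.drop l₁.length, (List.take_append_drop _ _).symm,
    higmanLE_iff.2 ⟨l₁, List.forall₂_take_append _ _ _ h1, ha⟩,
    higmanLE_iff.2 ⟨l₂, List.forall₂_drop_append _ _ _ h1, hb⟩⟩

theorem Atom.mem_lang_of_le (A : Atom X) {u v : List X} (h : HigmanLE u v) (hv : v ∈ A.lang) :
    u ∈ A.lang := by
  cases A with
  | star D =>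
    rw [mem_lang_star] at hv ⊢
    induction h with
    | nil => simp
    | cons hxy _ ih =>
      simp only [List.mem_cons, forall_eq_or_imp] at hv ⊢
      exact ⟨D.lower hxy hv.1, ih hv.2⟩
    | cons_right _ ih => exact ih fun x hx => hv x (List.mem_cons_of_mem _ hx)
  | opt I =>
    rw [mem_lang_opt] at hv ⊢
    rcases hv with rfl | ⟨x, hx, rfl⟩
    · cases h; exact Or.inl rfl
    · cases h with
      | nil => exact Or.inl rfl
      | cons hyx h' => cases h'; exact Or.inr ⟨_, I.lower hyx hx, rfl⟩
      | cons_right h' => cases h'; exact Or.inl rfl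

theorem Atom.directed (A : Atom X) {u v : List X} (hu : u ∈ A.lang) (hv : v ∈ A.lang) :
    ∃ w ∈ A.lang, HigmanLE u w ∧ HigmanLE v w := by
  cases A with
  | star D =>
    rw [mem_lang_star] at hu hv
    refine ⟨u ++ v, ?_, ?_, ?_⟩
    · rw [mem_lang_star]
      intro x hx
      rcases List.mem_append.1 hx with hx | hx
      exacts [hu x hx, hv x hx]
    · simpa using HigmanLE.append (refl u : HigmanLE u u) (SublistForall₂.nil : HigmanLE [] v)
    · simpa using HigmanLE.append (SublistForall₂.nil : HigmanLE [] u) (refl v : HigmanLE v v)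
  | opt I =>
    rcases hu with rfl | ⟨x, hx, rfl⟩
    · exact ⟨v, hv, SublistForall₂.nil, refl v⟩
    · rcases hv with rfl | ⟨y, hy, rfl⟩
      · exact ⟨[x], Or.inr ⟨x, hx, rfl⟩, refl _, SublistForall₂.nil⟩
      · obtain ⟨z, hz, hxz, hyz⟩ := I.directed x hx y hy
        exact ⟨[z], Or.inr ⟨z, hz, rfl⟩, .cons hxz .nil, .cons hyz .nil⟩

theorem productLang_nil_mem (P : List (Atom X)) : [] ∈ productLang P := by
  induction P with
  | nil => exact mem_productLang_nil.2 rfl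
  | cons A P ih => exact mem_productLang_cons.2 ⟨[], A.nil_mem_lang, [], ih, rfl⟩

theorem productLang_lower (P : List (Atom X)) {u v : List X} (h : HigmanLE u v)
    (hv : v ∈ productLang P) : u ∈ productLang P := by
  induction P generalizing u v with
  | nil =>
    rw [mem_productLang_nil] at hv ⊢
    subst hv
    cases h
    rfl
  | cons A P ih =>
    obtain ⟨a, ha, b, hb, rfl⟩ := mem_productLang_cons.1 hv
    obtain ⟨c, d, rfl, hc, hd⟩ := h.split
    exact mem_productLang_cons.2 ⟨c, A.mem_lang_of_le hc ha, d, ih hd hb, rfl⟩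

theorem productLang_directed (P : List (Atom X)) {u v : List X} (hu : u ∈ productLang P)
    (hv : v ∈ productLang P) : ∃ w ∈ productLang P, HigmanLE u w ∧ HigmanLE v w := by
  induction P generalizing u v with
  | nil =>
    rw [mem_productLang_nil] at hu hv
    subst hu hv
    exact ⟨[], mem_productLang_nil.2 rfl, .nil, .nil⟩
  | cons A P ih =>
    obtain ⟨a, ha, b, hb, rfl⟩ := mem_productLang_cons.1 hu
    obtain ⟨c, hc, d, hd, rfl⟩ := mem_productLang_cons.1 hv
    obtain ⟨e, he, hae, hce⟩ := A.directed ha hc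
    obtain ⟨f, hf, hbf, hdf⟩ := ih hb hd
    exact ⟨e ++ f, mem_productLang_cons.2 ⟨e, he, f, hf, rfl⟩, hae.append hbf, hce.append hdf⟩

end AtomFacts

/-- The ideal of multisets denoted by a product of atoms: all multisets having a
representative in the product. -/
def productIdeal {X : Type u} [Preorder X] (P : List (Atom X)) : Order.Ideal (FinMultiset X) where
  carrier := {M | ∃ w ∈ productLang P, FinMultiset.ofList w = M}
  lower' := by
    rintro _ _ ⟨u, v, rfl, hv, h⟩ ⟨w, hw, rfl⟩
    obtain ⟨u', hu, hu'⟩ := h.exists_perm (FinMultiset.ofList_eq.1 hv)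
    exact ⟨u', productLang_lower P hu' hw, FinMultiset.ofList_eq.2 hu.symm⟩
  nonempty' := ⟨_, [], productLang_nil_mem P, rfl⟩
  directed' := by
    rintro _ ⟨u, hu, rfl⟩ _ ⟨v, hv, rfl⟩
    obtain ⟨w, hw, huw, hvw⟩ := productLang_directed P hu hv
    exact ⟨_, ⟨w, hw, rfl⟩, ⟨u, w, rfl, rfl, huw⟩, ⟨v, w, rfl, rfl, hvw⟩⟩

/-- Closure of a set of sequences under permutation. -/
def permClosure {X : Type u} (L : Set (List X)) : Set (List X) :=
  {v | ∃ u ∈ L, u.Perm v}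

/-- The union of the generators `E` of the factors `E*` of a product of atoms. -/
def starPart {X : Type u} [Preorder X] (P : List (Atom X)) : LowerSet X :=
  sSup {E | Atom.star E ∈ P}

/-- The ideals `I₁, …, Iₚ` that occur as factors `I + ε`, with repetitions, in order of
occurrence. -/
def idealFactors {X : Type u} [Preorder X] (P : List (Atom X)) : List (Order.Ideal X) :=
  P.filterMap fun
    | .star _ => none
    | .opt I => some I

/-- The product of atoms `D* (I_{σ(1)} + ε) D* ⋯ D* (I_{σ(p)} + ε) D*`. -/
def permutedProduct {X : Type u} [Preorder X] (P : List (Atom X))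
    (σ : Equiv.Perm (Fin (idealFactors P).length)) : List (Atom X) :=
  Atom.star (starPart P) ::
    (List.finRange (idealFactors P).length).flatMap fun i =>
      [Atom.opt ((idealFactors P).get (σ i)), Atom.star (starPart P)]

/-! ## Ideally effective well-quasi-orderings and their presentations -/

/-- A way to represent elements of `Y` by natural numbers: `ρ n = some y` if `n` is a valid
representation, of `y`, and `ρ n = none` if `n` is not valid. -/
abbrev Naming (Y : Type u) : Type u := ℕ → Option Y

open Classical in
/-- The numerical truth value of a proposition. -/
noncomputable def truthValue (p : Prop) : ℕ := if p then 1 else 0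

/-- `ρ` is a data structure for `Y`: every element has at least one representation, and `c` is
an algorithm that decides which natural numbers are valid representations. -/
def IsDataStructure {Y : Type u} (ρ : Naming Y) (c : Nat.Partrec.Code) : Prop :=
  (∀ y, ∃ n, ρ n = some y) ∧ ∀ n, c.eval n = Part.some (truthValue ((ρ n).isSome))

/-- The list `l` represents the downwards-closed set `D` as a finite union of ideals. -/
def RepresentsDown {X : Type u} [Preorder X] (ρI : Naming (Order.Ideal X)) (l : List ℕ)
    (D : Set X) : Prop :=
  (∀ n ∈ l, ∃ I, ρI n = some I) ∧ D = {x | ∃ n ∈ l, ∃ I, ρI n = some I ∧ x ∈ I}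

/-- The list `l` represents the upwards-closed set `U` as a finite union of principal filters. -/
def RepresentsUp {X : Type u} [Preorder X] (ρX : Naming X) (l : List ℕ) (U : Set X) : Prop :=
  (∀ n ∈ l, ∃ x, ρX n = some x) ∧ U = {y | ∃ n ∈ l, ∃ x, ρX n = some x ∧ x ≤ y}

/-- `c` is defined on input `n` and returns (the code of) a list with property `p`. -/
def ReturnsList (c : Nat.Partrec.Code) (n : ℕ) (p : List ℕ → Prop) : Prop :=
  ∃ l : List ℕ, c.eval n = Part.some (Encodable.encode l) ∧ p l

/-- The algorithms of an ideally effective WQO: deciders for the two data structures,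
and the seven operations. -/
structure Algorithms where
  /-- validity of representations of elements -/
  validElem : Nat.Partrec.Code
  /-- validity of representations of ideals -/
  validIdeal : Nat.Partrec.Code
  /-- the ordering on elements -/
  elemLE : Nat.Partrec.Code
  /-- inclusion of ideals -/
  idealLE : Nat.Partrec.Code
  /-- principal ideals -/
  principal : Nat.Partrec.Code
  /-- complementation of filters -/
  complFilter : Nat.Partrec.Code
  /-- intersection of filters -/
  interFilter : Nat.Partrec.Code
  /-- complementation of ideals -/
  complIdeal : Nat.Partrec.Code
  /-- intersection of ideals -/
  interIdeal : Nat.Partrec.Code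

/-- The algorithms `A` are correct for the quasi-ordering `X`, with representations `ρX` of its
elements and `ρI` of its ideals.  Filters are represented by their least elements. -/
structure Algorithms.Correct {X : Type u} [Preorder X] (A : Algorithms) (ρX : Naming X)
    (ρI : Naming (Order.Ideal X)) : Prop where
  elems : IsDataStructure ρX A.validElem
  ideals : IsDataStructure ρI A.validIdeal
  elemLE : ∀ m n x y, ρX m = some x → ρX n = some y →
    A.elemLE.eval (Nat.pair m n) = Part.some (truthValue (x ≤ y))
  idealLE : ∀ m n I J, ρI m = some I → ρI n = some J →
    A.idealLE.eval (Nat.pair m n) = Part.some (truthValue ((I : Set X) ⊆ J))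
  principal : ∀ n x, ρX n = some x →
    ∃ k, A.principal.eval n = Part.some k ∧ ρI k = some (Order.Ideal.principal x)
  complFilter : ∀ n x, ρX n = some x →
    ReturnsList A.complFilter n fun l => RepresentsDown ρI l (Set.Ici x)ᶜ
  interFilter : ∀ m n x y, ρX m = some x → ρX n = some y →
    ReturnsList A.interFilter (Nat.pair m n) fun l => RepresentsUp ρX l (Set.Ici x ∩ Set.Ici y)
  complIdeal : ∀ n I, ρI n = some I →
    ReturnsList A.complIdeal n fun l => RepresentsUp ρX l (I : Set X)ᶜ
  interIdeal : ∀ m n I J, ρI m = some I → ρI n = some J →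
    ReturnsList A.interIdeal (Nat.pair m n) fun l => RepresentsDown ρI l ((I : Set X) ∩ J)

/-- `X`, with the data structures `ρX` and `ρI` for elements and ideals, is an ideally effective
well-quasi-ordering. -/
def IdeallyEffective {X : Type u} [Preorder X] (ρX : Naming X) (ρI : Naming (Order.Ideal X)) :
    Prop :=
  WellQuasiOrderedLE X ∧ ∃ A : Algorithms, A.Correct ρX ρI

/-- A presentation, as a finite object: algorithms, together with an ideal decomposition and a
filter decomposition of the whole set. -/
structure Presentation where
  algorithms : Algorithms
  idealDecomposition : List ℕ
  filterDecomposition : List ℕ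

/-- `P` is a presentation of the WQO `X` with data structures `ρX` and `ρI`. -/
structure Presentation.Presents {X : Type u} [Preorder X] (P : Presentation) (ρX : Naming X)
    (ρI : Naming (Order.Ideal X)) : Prop where
  wqo : WellQuasiOrderedLE X
  correct : P.algorithms.Correct ρX ρI
  ideals : RepresentsDown ρI P.idealDecomposition Set.univ
  filters : RepresentsUp ρX P.filterDecomposition Set.univ

/-- A presentation as a tuple of its components. -/
def Presentation.equivTuple : Presentation ≃
    (Nat.Partrec.Code × Nat.Partrec.Code × Nat.Partrec.Code × Nat.Partrec.Code ×
      Nat.Partrec.Code × Nat.Partrec.Code × Nat.Partrec.Code × Nat.Partrec.Code ×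
      Nat.Partrec.Code) × List ℕ × List ℕ where
  toFun P := ((P.algorithms.validElem, P.algorithms.validIdeal, P.algorithms.elemLE,
    P.algorithms.idealLE, P.algorithms.principal, P.algorithms.complFilter,
    P.algorithms.interFilter, P.algorithms.complIdeal, P.algorithms.interIdeal),
    P.idealDecomposition, P.filterDecomposition)
  invFun t := ⟨⟨t.1.1, t.1.2.1, t.1.2.2.1, t.1.2.2.2.1, t.1.2.2.2.2.1, t.1.2.2.2.2.2.1,
    t.1.2.2.2.2.2.2.1, t.1.2.2.2.2.2.2.2.1, t.1.2.2.2.2.2.2.2.2⟩, t.2.1, t.2.2⟩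
  left_inv _ := rfl
  right_inv _ := rfl

instance Presentation.instPrimcodable : Primcodable Presentation :=
  Primcodable.ofEquiv _ Presentation.equivTuple

/-! ## Ideally effective constructors -/

/-- A one-argument order-theoretic constructor, together with the data structures it uses for
elements and ideals, given data structures for its argument. -/
structure Constructor where
  carrier : (X : Type u) → [Preorder X] → Type u
  order : (X : Type u) → [Preorder X] → Preorder (carrier X)
  elemNaming : {X : Type u} → [Preorder X] → Naming X → Naming (carrier X)
  idealNaming : {X : Type u} → [Preorder X] → Naming (Order.Ideal X) →
    Naming (Order.Ideal (carrier X))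

attribute [instance] Constructor.order

/-- The constructor preserves WQOs and ideal effectiveness, and a presentation of its result is
uniformly computable from a presentation of its argument. -/
def Constructor.IsIdeallyEffective (C : Constructor.{u}) : Prop :=
  (∀ (X : Type u) [Preorder X], WellQuasiOrderedLE X → WellQuasiOrderedLE (C.carrier X)) ∧
  (∀ (X : Type u) [Preorder X] (ρX : Naming X) (ρI : Naming (Order.Ideal X)),
    IdeallyEffective ρX ρI → IdeallyEffective (C.elemNaming ρX) (C.idealNaming ρI)) ∧
  ∃ F : Presentation → Presentation, Computable F ∧
    ∀ (X : Type u) [Preorder X] (ρX : Naming X) (ρI : Naming (Order.Ideal X)) (P : Presentation),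
      P.Presents ρX ρI → (F P).Presents (C.elemNaming ρX) (C.idealNaming ρI)

/-- A multiset is represented by a list of representations of its elements, in any order. -/
def multisetNaming {X : Type u} (ρX : Naming X) : Naming (FinMultiset X) := fun n =>
  (Encodable.decode n : Option (List ℕ)).bind fun l => (l.mapM ρX).map FinMultiset.ofList

/-- The downwards-closed set that is the union of the given ideals. -/
def unionOfIdeals {X : Type u} [Preorder X] (l : List (Order.Ideal X)) : LowerSet X :=
  sSup {E | ∃ I ∈ l, E = I.toLowerSet}

/-- Representation of atoms: a representation of `I` stands for `I + ε`, and a list of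
representations of ideals with union `D` stands for `D*`. -/
def atomOfCode {X : Type u} [Preorder X] (ρI : Naming (Order.Ideal X)) :
    ℕ ⊕ List ℕ → Option (Atom X)
  | .inl n => (ρI n).map Atom.opt
  | .inr l => (l.mapM ρI).map fun Is => Atom.star (unionOfIdeals Is)

/-- An ideal of multisets is represented by a list of atoms of whose product it is the closure
under permutation. -/
def multisetIdealNaming {X : Type u} [Preorder X] (ρI : Naming (Order.Ideal X)) :
    Naming (Order.Ideal (FinMultiset X)) := fun n =>
  (Encodable.decode n : Option (List (ℕ ⊕ List ℕ))).bind fun l =>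
    (l.mapM (atomOfCode ρI)).map productIdeal

/-- Finite multisets with multiset embedding, as a constructor. -/
def multisetConstructor : Constructor.{u} where
  carrier X _ := FinMultiset X
  order X _ := FinMultiset.instPreorder X
  elemNaming ρX := multisetNaming ρX
  idealNaming ρI := multisetIdealNaming ρI

/-!
Multiset embedding, membership in the closure of a product of atoms, and inclusion of such closures
are all instances of one notion, the matching (`Matches`): some elements of a multiset are exempt,
the others get distinct partners in a second multiset. The multiset `M` belongs to the closure of
`P` if those elements of `M` outside the union `D` of the generators of the factors `E*` can be
matched into the factors `I + ε` (`mem_productIdeal_iff`). This characterization does not depend on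
the order of the factors. The description of the closure as a union over permutations
(`permClosure_productLang`) follows, because a word that can be matched can be read letter by
letter, each matched letter choosing the next factor.

For ideal effectiveness, three facts about the ordering are used. Inclusion of closures of products
is again a matching, now between the factors `I + ε` of the two products
(`productIdeal_subset_iff`); the reason is that an ideal contains an element that lies only in
those among finitely many lower sets that contain the whole ideal. Each ideal of multisets is the
closure of a product of atoms (`exists_productIdeal_eq`), so that all ideals are represented. And
the upper sets that have to be computed, complements of ideals and intersections of filters, have
bases of multisets of bounded size with elements from a finite, computable subset of `X`
(`exists_small_notMem_productIdeal`, `exists_small_upper_bound`). Such a subset is one that resolves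
the relevant upper sets of `X`: each element of `X` lies above a member of the subset that belongs
to the same ones among these upper sets (`Presentation.Resolves`).

The algorithms are obtained from these facts by search. A semidecidable relation between inputs and
outputs has a partial recursive choice function, whose program depends computably on a presentation
that occurs as a parameter (`Semidecidable.exists_codes`). It is therefore enough to state, for each
operation, a semidecidable relation that only holds for correct outputs and that holds for some
output. For the operations that return lower sets this is possible over every
well-quasi-ordering in which the other operations are available (`Presentation.exists_completion`):
a finite resolving set certifies that a given finite union of ideals is large enough.
-/

/-! ### Semidecidable relations -/

attribute [fun_prop] Primrec
attribute [fun_prop] Primrec.id Primrec.const Primrec.comp Primrec.pair Primrec.fst Primrec.snd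
attribute [fun_prop] Primrec.encode Primrec.list_length

section PrimrecRules

variable {α β γ σ : Type*} [Primcodable α] [Primcodable β] [Primcodable γ] [Primcodable σ]

@[fun_prop]
theorem Primrec.fst_comp {f : α → β × γ} (hf : Primrec f) : Primrec fun a => (f a).1 :=
  Primrec.fst.comp hf

@[fun_prop]
theorem Primrec.snd_comp {f : α → β × γ} (hf : Primrec f) : Primrec fun a => (f a).2 :=
  Primrec.snd.comp hf

@[fun_prop]
theorem Primrec.natPair_comp {f g : α → ℕ} (hf : Primrec f) (hg : Primrec g) :
    Primrec fun a => Nat.pair (f a) (g a) :=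
  Primrec₂.natPair.comp hf hg

@[fun_prop]
theorem Primrec.natUnpair_comp {f : α → ℕ} (hf : Primrec f) : Primrec fun a => (f a).unpair :=
  Primrec.unpair.comp hf

@[fun_prop]
theorem Primrec.natAdd_comp {f g : α → ℕ} (hf : Primrec f) (hg : Primrec g) :
    Primrec fun a => f a + g a :=
  Primrec.nat_add.comp hf hg

/-- The list with a given code; the empty list if there is none. -/
def listOfCode (β : Type*) [Encodable β] (n : ℕ) : List β :=
  ((Encodable.decode n : Option (List β))).getD []

@[simp]
theorem listOfCode_encode (l : List β) : listOfCode β (Encodable.encode l) = l := by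
  simp [listOfCode]

@[fun_prop]
theorem Primrec.listOfCode_comp {f : α → ℕ} (hf : Primrec f) :
    Primrec fun a => listOfCode β (f a) :=
  Primrec.option_getD.comp (Primrec.decode.comp hf) (Primrec.const [])

@[fun_prop]
theorem Primrec.some_comp {f : α → β} (hf : Primrec f) : Primrec fun a => some (f a) :=
  Primrec.option_some.comp hf

@[fun_prop]
theorem Primrec.inl_comp {f : α → β} (hf : Primrec f) :
    Primrec fun a => (Sum.inl (f a) : β ⊕ γ) :=
  Primrec.sumInl.comp hf

@[fun_prop]
theorem Primrec.inr_comp {f : α → γ} (hf : Primrec f) :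
    Primrec fun a => (Sum.inr (f a) : β ⊕ γ) :=
  Primrec.sumInr.comp hf

@[fun_prop]
theorem Primrec.sumElim_comp {f : α → β ⊕ γ} {g : β → σ} {h : γ → σ} (hf : Primrec f)
    (hg : Primrec g) (hh : Primrec h) : Primrec fun a => Sum.elim g h (f a) :=
  (Primrec.sumCasesOn hf (hg.comp Primrec.snd).to₂ (hh.comp Primrec.snd).to₂).of_eq fun a => by
    cases f a <;> rfl

@[fun_prop]
theorem Primrec.listCons_comp {f : α → β} {g : α → List β} (hf : Primrec f) (hg : Primrec g) :
    Primrec fun a => f a :: g a :=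
  Primrec.list_cons.comp hf hg

@[fun_prop]
theorem Primrec.listAppend_comp {f g : α → List β} (hf : Primrec f) (hg : Primrec g) :
    Primrec fun a => f a ++ g a :=
  Primrec.list_append.comp hf hg

@[fun_prop]
theorem Primrec.listRange_comp {f : α → ℕ} (hf : Primrec f) : Primrec fun a => List.range (f a) :=
  Primrec.list_range.comp hf

@[fun_prop]
theorem Primrec.listMap_comp {f : α → List β} {g : α → β → γ} (hf : Primrec f)
    (hg : Primrec fun p : α × β => g p.1 p.2) : Primrec fun a => (f a).map (g a) :=
  Primrec.list_map hf hg

@[fun_prop]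
theorem Primrec.listFlatMap_comp {f : α → List β} {g : α → β → List γ} (hf : Primrec f)
    (hg : Primrec fun p : α × β => g p.1 p.2) : Primrec fun a => (f a).flatMap (g a) :=
  Primrec.list_flatMap hf hg

@[fun_prop]
theorem Primrec.listFilterMap_comp {f : α → List β} {g : α → β → Option γ} (hf : Primrec f)
    (hg : Primrec fun p : α × β => g p.1 p.2) : Primrec fun a => (f a).filterMap (g a) :=
  Primrec.listFilterMap hf hg

@[fun_prop]
theorem Primrec.listSections_comp {f : α → List (List β)} (hf : Primrec f) :
    Primrec fun a => (f a).sections := by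
  have h : Primrec fun a => (f a).foldr (fun l S => S.flatMap fun s => l.map fun b => b :: s)
      [[]] := by
    refine Primrec.list_foldr hf (Primrec.const _) (h := fun _ (p : List β × List (List β)) =>
      p.2.flatMap fun s => p.1.map fun b => b :: s) ?_
    unfold Primrec₂
    fun_prop
  refine h.of_eq fun a => ?_
  induction f a with
  | nil => rfl
  | cons l L ih => rw [List.foldr_cons, ih]; rfl

/-- Used for comparing lists as multisets: `l.Subperm m` says that no element has more occurrences
in `l` than in `m`. -/
theorem PrimrecRel.count_le [DecidableEq β] {f g : α → List β} (hf : Primrec f) (hg : Primrec g) :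
    PrimrecPred fun a => ∀ x ∈ f a, (f a).count x ≤ (g a).count x := by
  have hc : Primrec fun q : β × List β => q.2.count q.1 := by
    have h : PrimrecRel fun (x y : β) => x = y := Primrec.eq
    refine (Primrec.list_length.comp (h.listFilter.comp Primrec.snd Primrec.fst)).of_eq ?_
    rintro ⟨x, l⟩
    simp only [List.count_eq_length_filter]
    congr 2
  have hc' {δ : Type _} [Primcodable δ] {p : δ → β} {q : δ → List β} (hp : Primrec p)
      (hq : Primrec q) : Primrec fun a => (q a).count (p a) := hc.comp (hp.pair hq)
  have h : PrimrecRel fun (x : β) (q : List β × List β) => q.1.count x ≤ q.2.count x :=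
    Primrec.nat_le.comp (hc' Primrec.fst (by fun_prop)) (hc' Primrec.fst (by fun_prop))
  exact h.forall_mem_list.comp hf (hf.pair hg)

end PrimrecRules

/-- A predicate is semidecidable if it is the projection of a primitive recursive relation.
The rules below make `fun_prop` prove semidecidability from the logical form of a predicate. -/
@[fun_prop]
def Semidecidable {α : Type*} [Primcodable α] (p : α → Prop) : Prop :=
  ∃ q : α → ℕ → Prop, PrimrecRel q ∧ ∀ a, p a ↔ ∃ k, q a k

namespace Semidecidable

variable {α β γ : Type*} [Primcodable α] [Primcodable β] [Primcodable γ]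

theorem of_primrecPred {p : α → Prop} (hp : PrimrecPred p) : Semidecidable p :=
  ⟨fun a _ => p a, hp.comp Primrec.fst, fun a => by simp⟩

@[fun_prop]
theorem and {p q : α → Prop} (hp : Semidecidable p) (hq : Semidecidable q) :
    Semidecidable fun a => p a ∧ q a := by
  obtain ⟨p', hp', h⟩ := hp
  obtain ⟨q', hq', h'⟩ := hq
  refine ⟨fun a k => p' a k.unpair.1 ∧ q' a k.unpair.2, PrimrecPred.and
    (hp'.comp (by fun_prop) (by fun_prop)) (hq'.comp (by fun_prop) (by fun_prop)), fun a => ?_⟩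
  simp only [h, h']
  constructor
  · rintro ⟨⟨k, hk⟩, l, hl⟩
    exact ⟨Nat.pair k l, by simpa using ⟨hk, hl⟩⟩
  · rintro ⟨k, hk, hl⟩
    exact ⟨⟨_, hk⟩, _, hl⟩

@[fun_prop]
theorem or {p q : α → Prop} (hp : Semidecidable p) (hq : Semidecidable q) :
    Semidecidable fun a => p a ∨ q a := by
  obtain ⟨p', hp', h⟩ := hp
  obtain ⟨q', hq', h'⟩ := hq
  refine ⟨fun a k => p' a k ∨ q' a k, PrimrecPred.or hp' hq', fun a => ?_⟩
  simp only [h, h', exists_or]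

@[fun_prop]
theorem ex {p : α → β → Prop} (hp : Semidecidable fun a : α × β => p a.1 a.2) :
    Semidecidable fun a => ∃ b, p a b := by
  obtain ⟨q, hq, h⟩ := hp
  refine ⟨fun a k => ∃ b ∈ (Encodable.decode k.unpair.1 : Option β).toList,
    q (a, b) k.unpair.2, ?_, fun a => ?_⟩
  · have h1 : PrimrecRel fun (b : β) (r : α × ℕ) => q (r.1, b) r.2 := hq.comp (by fun_prop)
      (by fun_prop)
    exact h1.exists_mem_list.comp
      (f := fun r : α × ℕ => (Encodable.decode r.2.unpair.1 : Option β).toList)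
      (g := fun r : α × ℕ => (r.1, r.2.unpair.2))
      (Primrec.optionToList.comp (Primrec.decode.comp (by fun_prop))) (by fun_prop)
  · constructor
    · rintro ⟨b, hb⟩
      obtain ⟨k, hk⟩ := (h (a, b)).1 hb
      exact ⟨Nat.pair (Encodable.encode b) k, b, by simp, by simpa using hk⟩
    · rintro ⟨k, b, -, hb⟩
      exact ⟨b, (h (a, b)).2 ⟨_, hb⟩⟩

/-- A bounded number of witnesses has a common bound. -/
@[fun_prop]
theorem ball {l : α → List β} {p : α → β → Prop} (hl : Primrec l)
    (hp : Semidecidable fun a : α × β => p a.1 a.2) :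
    Semidecidable fun a => ∀ b ∈ l a, p a b := by
  obtain ⟨q, hq, h⟩ := hp
  refine ⟨fun a k => ∀ b ∈ l a, ∃ i ∈ List.range k, q (a, b) i, ?_, fun a => ?_⟩
  · have h1 : PrimrecRel fun (i : ℕ) (r : α × β) => q r i := hq.comp (by fun_prop) (by fun_prop)
    have h2 : PrimrecRel fun (b : β) (r : α × ℕ) => ∃ i ∈ List.range r.2, q (r.1, b) i :=
      h1.exists_mem_list.comp (by fun_prop) (by fun_prop)
    exact h2.forall_mem_list.comp (by fun_prop) (by fun_prop)
  · simp only [fun b => h (a, b), List.mem_range]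
    constructor
    · intro hb
      replace hb : ∀ b ∈ l a, ∃ k, q (a, b) k := hb
      generalize l a = s at hb
      induction s with
      | nil => simp
      | cons b s ih =>
        simp only [List.mem_cons, forall_eq_or_imp] at hb ⊢
        obtain ⟨⟨i, hi⟩, hs⟩ := hb
        obtain ⟨k, hk⟩ := ih hs
        refine ⟨max (i + 1) k, ⟨i, by omega, hi⟩, fun b hb => ?_⟩
        obtain ⟨j, hj, hjb⟩ := hk b hb
        exact ⟨j, by omega, hjb⟩
    · rintro ⟨k, hk⟩ b hb
      obtain ⟨i, -, hi⟩ := hk b hb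
      exact ⟨i, hi⟩

@[fun_prop]
theorem mem {l : α → List β} {f : α → β} (hl : Primrec l) (hf : Primrec f) :
    Semidecidable fun a => f a ∈ l a := by
  classical
  have h : PrimrecRel fun (x y : β) => x = y := Primrec.eq
  refine of_primrecPred ((h.exists_mem_list.comp hl hf).of_eq fun a => ?_)
  simp

@[fun_prop]
theorem eq {f g : α → β} (hf : Primrec f) (hg : Primrec g) :
    Semidecidable fun a => f a = g a := by
  classical
  exact of_primrecPred (Primrec.eq.comp hf hg)

@[fun_prop]
theorem subperm {f g : α → List β} (hf : Primrec f) (hg : Primrec g) :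
    Semidecidable fun a => (f a).Subperm (g a) := by
  classical
  exact of_primrecPred ((PrimrecRel.count_le hf hg).of_eq fun a => List.subperm_ext_iff.symm)

@[fun_prop]
theorem not_subperm {f g : α → List β} (hf : Primrec f) (hg : Primrec g) :
    Semidecidable fun a => ¬ (f a).Subperm (g a) := by
  classical
  exact of_primrecPred
    ((PrimrecRel.count_le hf hg).of_eq fun a => List.subperm_ext_iff.symm).not

@[fun_prop]
theorem mem_eval {c : α → Nat.Partrec.Code} {n m : α → ℕ} (hc : Primrec c) (hn : Primrec n)
    (hm : Primrec m) : Semidecidable fun a => m a ∈ (c a).eval (n a) := by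
  refine ⟨fun a k => Nat.Partrec.Code.evaln k (c a) (n a) = some (m a), ?_, fun a => ?_⟩
  · refine Primrec.eq.comp (Nat.Partrec.Code.primrec_evaln.comp
      (g := fun r : α × ℕ => ((r.2, c r.1), n r.1)) ?_) ?_ <;> fun_prop
  · exact Nat.Partrec.Code.evaln_complete

/-- A semidecidable relation has a partial recursive choice function, and this uniformly in a
parameter: a program for it is obtained from the parameter by the s-m-n theorem. -/
theorem exists_codes {R : γ → ℕ → ℕ → Prop}
    (hR : Semidecidable fun a : (γ × ℕ) × ℕ => R a.1.1 a.1.2 a.2) :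
    ∃ f : γ → Nat.Partrec.Code, Primrec f ∧
      ∀ c n, (∃ m, R c n m) → ∃ m, (f c).eval n = Part.some m ∧ R c n m := by
  classical
  obtain ⟨q, ⟨hdec, hq⟩, h⟩ := hR
  -- Search through the pairs of a candidate output and a witness.
  let g : γ × ℕ → ℕ → Option ℕ := fun a k =>
    if q (a, k.unpair.1) k.unpair.2 then some k.unpair.1 else none
  have hg : Primrec₂ g := by
    refine Primrec.ite ?_ ?_ (Primrec.const _)
    · exact PrimrecPred.comp (p := fun r : ((γ × ℕ) × ℕ) × ℕ => q r.1 r.2) ⟨hdec, hq⟩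
        (f := fun r : (γ × ℕ) × ℕ => ((r.1, r.2.unpair.1), r.2.unpair.2)) (by fun_prop)
    · fun_prop
  have hgP : Partrec fun a => Nat.rfindOpt (g a) := Partrec.rfindOpt hg.to_comp
  obtain ⟨code, hcode⟩ := Nat.Partrec.Code.exists_code.1 hgP
  refine ⟨fun c => code.curry (Encodable.encode c),
    Nat.Partrec.Code.primrec₂_curry.comp (Primrec.const _) Primrec.encode, fun c n hm => ?_⟩
  have heval : (code.curry (Encodable.encode c)).eval n = Nat.rfindOpt (g (c, n)) := by
    rw [Nat.Partrec.Code.eval_curry, hcode,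
      show Nat.pair (Encodable.encode c) n = Encodable.encode (c, n) from rfl]
    simpa using Part.map_id' (f := Encodable.encode) (fun _ => rfl) _
  obtain ⟨m, hm⟩ := hm
  obtain ⟨k, hk⟩ := (h ((c, n), m)).1 hm
  have hdom : (Nat.rfindOpt (g (c, n))).Dom :=
    Nat.rfindOpt_dom.2 ⟨Nat.pair m k, m, by simp [g, hk]⟩
  obtain ⟨m', hm'⟩ := Part.dom_iff_mem.1 hdom
  refine ⟨m', by rw [heval]; exact Part.eq_some_iff.2 hm', ?_⟩
  obtain ⟨k', hk'⟩ := Nat.rfindOpt_spec hm'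
  simp only [g, Option.mem_def, Option.ite_none_right_eq_some, Option.some.injEq] at hk'
  obtain ⟨hq', rfl⟩ := hk'
  exact (h _).2 ⟨_, hq'⟩

end Semidecidable

/-! ### Matchings of multisets -/

/-- The multiset `M` can be matched into `N`: some elements of `M` satisfy `D` and stay unmatched,
the others are paired with distinct occurrences in `N`, along `R`.  Multiset embedding, membership
in the ideal of a product of atoms, and inclusion of such ideals are all of this form. -/
def Matches {α β : Type*} (R : α → β → Prop) (D : α → Prop) (M : Multiset α) (N : Multiset β) :
    Prop :=
  ∃ d s t, M = d + s ∧ (∀ x ∈ d, D x) ∧ Multiset.Rel R s t ∧ t ≤ N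

namespace Matches

variable {α β γ δ : Type*} {R R' : α → β → Prop} {D D' : α → Prop} {M M' : Multiset α}
  {N N' : Multiset β}

theorem zero_left (R : α → β → Prop) (D : α → Prop) (N : Multiset β) : Matches R D 0 N :=
  ⟨0, 0, 0, by simp, by simp, .zero, Multiset.zero_le _⟩

theorem free {x : α} (hx : D x) (h : Matches R D M N) : Matches R D (x ::ₘ M) N := by
  obtain ⟨d, s, t, rfl, hd, hst, ht⟩ := h
  exact ⟨x ::ₘ d, s, t, by simp, by simpa using ⟨hx, hd⟩, hst, ht⟩

theorem pair {x : α} {y : β} (hx : R x y) (h : Matches R D M N) :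
    Matches R D (x ::ₘ M) (y ::ₘ N) := by
  obtain ⟨d, s, t, rfl, hd, hst, ht⟩ := h
  exact ⟨d, x ::ₘ s, y ::ₘ t, by simp, hd, .cons hx hst, Multiset.cons_le_cons _ ht⟩

theorem cons_left {x : α} : Matches R D (x ::ₘ M) N ↔
    (D x ∧ Matches R D M N) ∨ ∃ y N', N = y ::ₘ N' ∧ R x y ∧ Matches R D M N' := by
  constructor
  · rintro ⟨d, s, t, h, hd, hst, ht⟩
    have hx : x ∈ d + s := h ▸ Multiset.mem_cons_self _ _
    rcases Multiset.mem_add.1 hx with hx | hx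
    · obtain ⟨d, rfl⟩ := Multiset.exists_cons_of_mem hx
      rw [Multiset.cons_add, Multiset.cons_inj_right] at h
      exact .inl ⟨hd x (Multiset.mem_cons_self _ _),
        d, s, t, h, fun y hy => hd y (Multiset.mem_cons_of_mem hy), hst, ht⟩
    · obtain ⟨s, rfl⟩ := Multiset.exists_cons_of_mem hx
      rw [Multiset.add_cons, Multiset.cons_inj_right] at h
      obtain ⟨y, t, hxy, hst', rfl⟩ := Multiset.rel_cons_left.1 hst
      obtain ⟨N', rfl⟩ := Multiset.exists_cons_of_mem (Multiset.mem_of_le ht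
        (Multiset.mem_cons_self _ _))
      exact .inr ⟨y, N', rfl, hxy, d, s, t, h, hd, hst', (Multiset.cons_le_cons_iff _).1 ht⟩
  · rintro (⟨hx, h⟩ | ⟨y, N', rfl, hxy, h⟩)
    exacts [h.free hx, h.pair hxy]

theorem mono (h : Matches R D M N) (hD : ∀ x ∈ M, D x → D' x)
    (hR : ∀ x ∈ M, ∀ y ∈ N, R x y → R' x y) : Matches R' D' M N := by
  obtain ⟨d, s, t, rfl, hd, hst, ht⟩ := h
  exact ⟨d, s, t, rfl, fun x hx => hD x (by simp [hx]) (hd x hx),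
    hst.mono fun x hx y hy => hR x (by simp [hx]) y (Multiset.mem_of_le ht hy), ht⟩

theorem mono_right (h : Matches R D M N) (hN : N ≤ N') : Matches R D M N' := by
  obtain ⟨d, s, t, rfl, hd, hst, ht⟩ := h
  exact ⟨d, s, t, rfl, hd, hst, ht.trans hN⟩

/-- Elements that satisfy `D` can be added to the left side without further partners. -/
theorem add_free (h : Matches R D M N) {K : Multiset α} (hK : ∀ x ∈ K, D x) :
    Matches R D (M + K) N := by
  obtain ⟨d, s, t, rfl, hd, hst, ht⟩ := h
  refine ⟨d + K, s, t, by ac_rfl, fun x hx => ?_, hst, ht⟩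
  rcases Multiset.mem_add.1 hx with hx | hx
  exacts [hd x hx, hK x hx]

theorem map_left {f : γ → α} {K : Multiset γ} :
    Matches R D (K.map f) N ↔ Matches (fun z => R (f z)) (fun z => D (f z)) K N := by
  induction K using Multiset.induction_on generalizing N with
  | empty => simp [zero_left]
  | cons x K ih => simp only [Multiset.map_cons, cons_left, ih]

theorem map_right {f : γ → β} {K : Multiset γ} :
    Matches R D M (K.map f) ↔ Matches (fun x z => R x (f z)) D M K := by
  constructor
  · classical
    intro h
    induction M using Multiset.induction_on generalizing K with
    | empty => exact zero_left _ _ _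
    | cons x M ih =>
      rcases cons_left.1 h with ⟨hx, h⟩ | ⟨y, N', hN, hxy, h⟩
      · exact (ih h).free hx
      · obtain ⟨z, hz, rfl, rfl⟩ := (Multiset.map_eq_cons f K N' y).2 hN
        rw [← Multiset.cons_erase hz]
        exact (ih h).pair hxy
  · rintro ⟨d, s, t, rfl, hd, hst, ht⟩
    exact ⟨d, s, t.map f, rfl, hd, Multiset.rel_map_right.2 hst, Multiset.map_le_map ht⟩

/-- Matchings compose.  An element is left unmatched if it is unmatched in the first matching, or if
its partner there is unmatched in the second. -/
theorem comp {S : β → γ → Prop} {E : β → Prop} {T : α → γ → Prop} {F : α → Prop}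
    {P : Multiset γ} (h : Matches R D M N) (h' : Matches S E N P)
    (hD : ∀ x, D x → F x) (hE : ∀ x y, R x y → E y → F x)
    (hS : ∀ x y z, R x y → S y z → T x z) : Matches T F M P := by
  induction M using Multiset.induction_on generalizing N P with
  | empty => exact zero_left _ _ _
  | cons x M ih =>
    rcases cons_left.1 h with ⟨hx, h⟩ | ⟨y, N, rfl, hxy, h⟩
    · exact (ih h h').free (hD x hx)
    · rcases cons_left.1 h' with ⟨hy, h'⟩ | ⟨z, P, rfl, hyz, h'⟩
      exacts [(ih h h').free (hE x y hxy hy), (ih h h').pair (hS x y z hxy hyz)]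

theorem card_le (h : Matches R D M N) (hM : ∀ x ∈ M, ¬ D x) :
    Multiset.card M ≤ Multiset.card N := by
  obtain ⟨d, s, t, rfl, hd, hst, ht⟩ := h
  have : d = 0 := Multiset.eq_zero_of_forall_notMem fun x hx => hM x (by simp [hx]) (hd x hx)
  subst this
  rw [zero_add, Multiset.card_eq_card_of_rel hst]
  exact Multiset.card_le_card ht

theorem of_forall (hM : ∀ x ∈ M, D x) (N : Multiset β) : Matches R D M N :=
  ⟨M, 0, 0, by simp, hM, .zero, Multiset.zero_le _⟩

end Matches

/-! ### Lower sets of a well-quasi-ordering -/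

section WQO

variable {X : Type u} [Preorder X]

theorem wellFounded_lowerSet_lt [WellQuasiOrderedLE X] :
    WellFounded fun D E : LowerSet X => D < E := by
  rw [wellFounded_iff_isEmpty_descending_chain]
  refine ⟨fun ⟨D, hD⟩ => ?_⟩
  have hanti : Antitone D := antitone_nat_of_succ_le fun n => (hD n).le
  choose x hx hx' using fun n => Set.exists_of_ssubset (LowerSet.coe_ssubset_coe.2 (hD n))
  obtain ⟨m, n, hmn, hle⟩ := wellQuasiOrdered_le x
  exact hx' m ((D (m + 1)).lower hle (hanti hmn (hx n)))

/-- In a well-quasi-ordering every lower set is a finite union of ideals: a minimal lower set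
without such a decomposition would be non-empty and not directed, hence a union of two smaller
lower sets. -/
theorem LowerSet.exists_ideals [WellQuasiOrderedLE X] (D : LowerSet X) :
    ∃ l : List (Order.Ideal X), ∀ x, x ∈ D ↔ ∃ I ∈ l, x ∈ I := by
  induction D using (wellFounded_lowerSet_lt (X := X)).induction with
  | _ D ih =>
  by_cases hne : (D : Set X).Nonempty
  swap
  · refine ⟨[], fun x => ?_⟩
    simpa using fun hx => hne ⟨x, hx⟩
  by_cases hdir : DirectedOn (· ≤ ·) (D : Set X)
  · exact ⟨[⟨D, hne, hdir⟩], fun x => by simp; rfl⟩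
  simp only [DirectedOn, not_forall, not_exists, not_and] at hdir
  obtain ⟨x, hx, y, hy, hxy⟩ := hdir
  have key : ∀ z ∈ D, D ⊓ (UpperSet.Ici z).compl < D := fun z hz =>
    lt_of_le_of_ne inf_le_left fun h => by
      have : z ∈ D ⊓ (UpperSet.Ici z).compl := h.symm ▸ hz
      exact this.2 le_rfl
  obtain ⟨l, hl⟩ := ih _ (key x hx)
  obtain ⟨m, hm⟩ := ih _ (key y hy)
  refine ⟨l ++ m, fun z => ?_⟩
  simp only [List.mem_append, or_and_right, exists_or, ← hl, ← hm]
  constructor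
  · intro hz
    by_cases hxz : x ≤ z
    · exact .inr ⟨hz, fun hyz => hxy z hz hxz hyz⟩
    · exact .inl ⟨hz, hxz⟩
  · rintro (h | h) <;> exact h.1

/-- In a well-quasi-ordering every upper set has a finite basis. -/
theorem UpperSet.exists_basis [WellQuasiOrderedLE X] (U : UpperSet X) :
    ∃ l : List X, ∀ y, y ∈ U ↔ ∃ x ∈ l, x ≤ y := by
  suffices h : ∀ (D : LowerSet X) (l : List X), (∀ x ∈ l, x ∈ U) →
      (∀ y, y ∈ D ↔ ∀ x ∈ l, ¬ x ≤ y) → ∃ l : List X, ∀ y, y ∈ U ↔ ∃ x ∈ l, x ≤ y from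
    h ⊤ [] (by simp) (by simp)
  -- As long as `l` is not a basis, extend it; `D` is the set of the elements not yet above `l`.
  intro D
  induction D using (wellFounded_lowerSet_lt (X := X)).induction with
  | _ D ih =>
  intro l hl hD
  by_cases h : ∃ y ∈ U, y ∈ D
  · obtain ⟨y, hyU, hyD⟩ := h
    refine ih (D ⊓ (UpperSet.Ici y).compl) ?_ (y :: l) (by simpa using ⟨hyU, hl⟩) fun z => ?_
    · refine lt_of_le_of_ne inf_le_left fun h => ?_
      have : y ∈ D ⊓ (UpperSet.Ici y).compl := h.symm ▸ hyD
      exact this.2 le_rfl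
    · simp only [LowerSet.mem_inf_iff, UpperSet.mem_compl_iff, UpperSet.mem_Ici_iff, hD,
        List.mem_cons, forall_eq_or_imp]
      exact and_comm
  · push Not at h
    refine ⟨l, fun y => ⟨fun hy => ?_, fun ⟨x, hx, hxy⟩ => U.upper hxy (hl x hx)⟩⟩
    simpa [hD] using h y hy

/-- Given finitely many lower sets, an ideal has an element outside all those that do not contain
the ideal: take an upper bound of one such element for each of them. -/
theorem Order.Ideal.exists_generic (I : Order.Ideal X) (l : List (LowerSet X)) :
    ∃ x ∈ I, ∀ D ∈ l, x ∈ D → (I : Set X) ⊆ D := by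
  induction l with
  | nil =>
    obtain ⟨x, hx⟩ := I.nonempty
    exact ⟨x, hx, by simp⟩
  | cons D l ih =>
    obtain ⟨x, hx, h⟩ := ih
    by_cases hD : (I : Set X) ⊆ D
    · exact ⟨x, hx, by simpa using ⟨fun _ => hD, h⟩⟩
    · obtain ⟨y, hy, hyD⟩ := Set.not_subset.1 hD
      obtain ⟨z, hz, hxz, hyz⟩ := I.directed x hx y hy
      refine ⟨z, hz, ?_⟩
      simp only [List.mem_cons, forall_eq_or_imp]
      exact ⟨fun hzD => absurd (D.lower hyz hzD) hyD, fun E hE hzE => h E hE (E.lower hxz hzE)⟩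

/-- An ideal covered by finitely many ideals is contained in one of them. -/
theorem Order.Ideal.exists_subset_of_forall_exists {l : List (Order.Ideal X)} {I : Order.Ideal X}
    (h : ∀ x ∈ I, ∃ J ∈ l, x ∈ J) : ∃ J ∈ l, (I : Set X) ⊆ J := by
  obtain ⟨x, hx, hx'⟩ := I.exists_generic (l.map Order.Ideal.toLowerSet)
  obtain ⟨J, hJ, hxJ⟩ := h x hx
  exact ⟨J, hJ, hx' _ (List.mem_map_of_mem hJ) hxJ⟩

end WQO

/-! ### Multiset embedding and products of atoms as matchings -/

section FinMultisets

variable {X : Type u} [Preorder X]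

/-- A finite multiset, forgetting that these are ordered by embedding. -/
def FinMultiset.toMultiset {X : Type u} (M : FinMultiset X) : Multiset X := M

@[simp]
theorem FinMultiset.toMultiset_ofList {X : Type u} (w : List X) :
    (FinMultiset.ofList w).toMultiset = (w : Multiset X) := rfl

/-- A multiset, to be ordered by embedding. -/
def FinMultiset.ofMultiset {X : Type u} (M : Multiset X) : FinMultiset X := M

@[simp]
theorem FinMultiset.toMultiset_ofMultiset {X : Type u} (M : Multiset X) :
    (FinMultiset.ofMultiset M).toMultiset = M := rfl

/-- `M` embeds into `N` if all elements of `M` can be matched into `N` along `≤`. -/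
theorem FinMultiset.le_iff {M N : FinMultiset X} :
    M ≤ N ↔ Matches (· ≤ ·) (fun _ => False) M.toMultiset N.toMultiset := by
  constructor
  · rintro ⟨u, v, rfl, rfl, h⟩
    simp only [toMultiset_ofList]
    induction h with
    | nil => exact Matches.zero_left _ _ _
    | cons hxy _ ih => exact ih.pair hxy
    | cons_right _ ih => exact ih.mono_right (Multiset.le_cons_self _ _)
  · obtain ⟨u, rfl⟩ := M.exists_ofList
    suffices h : ∀ N : Multiset X, Matches (· ≤ ·) (fun _ => False) (u : Multiset X) N →
        ∃ v : List X, (v : Multiset X) = N ∧ HigmanLE u v by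
      intro h'
      obtain ⟨v, hv, huv⟩ := h _ h'
      exact ⟨u, v, rfl, hv, huv⟩
    induction u with
    | nil =>
      intro N _
      exact ⟨N.toList, N.coe_toList, .nil⟩
    | cons x u ih =>
      intro N h
      rw [← Multiset.cons_coe, Matches.cons_left] at h
      obtain ⟨hf, -⟩ | ⟨y, N, rfl, hxy, h⟩ := h
      · exact hf.elim
      · obtain ⟨v, rfl, hv⟩ := ih N h
        exact ⟨y :: v, rfl, .cons hxy hv⟩

/-- Higman's lemma for multisets, from the one for sequences. -/
theorem FinMultiset.wellQuasiOrderedLE (hX : WellQuasiOrderedLE X) :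
    WellQuasiOrderedLE (FinMultiset X) := by
  refine ⟨fun f => ?_⟩
  choose w hw using fun n => (f n).exists_ofList
  have hH := Set.PartiallyWellOrderedOn.partiallyWellOrderedOn_sublistForall₂
    (fun x y : X => x ≤ y) (s := Set.univ)
    (Set.partiallyWellOrderedOn_univ_iff.2 wellQuasiOrdered_le)
  obtain ⟨m, n, hmn, h⟩ := hH.exists_lt (f := w) fun n x _ => Set.mem_univ x
  exact ⟨m, n, hmn, w m, w n, hw m, hw n, h⟩

theorem mem_starPart_cons_star {E : LowerSet X} {P : List (Atom X)} {x : X} :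
    x ∈ starPart (.star E :: P) ↔ x ∈ E ∨ x ∈ starPart P := by
  simp [starPart, LowerSet.mem_sSup_iff]

theorem starPart_cons_opt {I : Order.Ideal X} {P : List (Atom X)} :
    starPart (.opt I :: P) = starPart P := by
  simp [starPart]

theorem idealFactors_cons_star {E : LowerSet X} {P : List (Atom X)} :
    idealFactors (.star E :: P) = idealFactors P := rfl

theorem idealFactors_cons_opt {I : Order.Ideal X} {P : List (Atom X)} :
    idealFactors (.opt I :: P) = I :: idealFactors P := rfl

/-- Up to permutation, a product of atoms depends only on the union of its generators `E` of
factors `E*`, and on the multiset of its factors `I + ε`. -/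
theorem exists_perm_mem_productLang_iff {P : List (Atom X)} {M : Multiset X} :
    (∃ w ∈ productLang P, (w : Multiset X) = M) ↔
      Matches (fun x (I : Order.Ideal X) => x ∈ I) (· ∈ starPart P) M (idealFactors P) := by
  classical
  constructor
  · rintro ⟨w, hw, rfl⟩
    induction P generalizing w with
    | nil =>
      rw [mem_productLang_nil] at hw
      subst hw
      exact Matches.zero_left _ _ _
    | cons A P ih =>
      obtain ⟨a, ha, b, hb, rfl⟩ := mem_productLang_cons.1 hw
      have := ih b hb
      rw [← Multiset.coe_add, add_comm]
      cases A with
      | star E =>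
        refine Matches.add_free (this.mono (fun x _ hx => ?_) fun _ _ _ _ h => h) fun x hx => ?_
        · exact mem_starPart_cons_star.2 (.inr hx)
        · exact mem_starPart_cons_star.2 (.inl (ha x hx))
      | opt I =>
        rw [starPart_cons_opt, idealFactors_cons_opt, ← Multiset.cons_coe]
        rcases ha with rfl | ⟨x, hx, rfl⟩
        · simpa using this.mono_right (Multiset.le_cons_self _ _)
        · rw [add_comm, Multiset.coe_singleton, Multiset.singleton_add]
          exact this.pair hx
  · intro h
    induction P generalizing M with
    | nil =>
      refine ⟨[], mem_productLang_nil.2 rfl, ?_⟩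
      obtain ⟨d, s, t, rfl, hd, hst, ht⟩ := h
      obtain rfl : t = 0 := Multiset.le_zero.1 ht
      obtain rfl : s = 0 := by simpa using hst
      obtain rfl : d = 0 := Multiset.eq_zero_of_forall_notMem fun x hx => by
        simpa [starPart, LowerSet.mem_sSup_iff] using hd x hx
      rfl
    | cons A P ih =>
      cases A with
      | star E =>
        obtain ⟨d, s, t, rfl, hd, hst, ht⟩ := h
        obtain ⟨b, hb, hbM⟩ := ih (M := d.filter (· ∉ E) + s) ⟨_, s, t, rfl, fun x hx => by
          rw [Multiset.mem_filter] at hx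
          exact (mem_starPart_cons_star.1 (hd x hx.1)).resolve_left hx.2, hst, ht⟩
        refine ⟨(d.filter (· ∈ E)).toList ++ b, mem_productLang_cons.2 ⟨_, ?_, b, hb, rfl⟩, ?_⟩
        · intro x hx
          exact (Multiset.mem_filter.1 (Multiset.mem_toList.1 hx)).2
        · rw [← Multiset.coe_add, Multiset.coe_toList, hbM, ← add_assoc,
            Multiset.filter_add_not]
      | opt I =>
        obtain ⟨d, s, t, rfl, hd, hst, ht⟩ := h
        rw [starPart_cons_opt] at hd
        rw [idealFactors_cons_opt, ← Multiset.cons_coe] at ht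
        by_cases hI : I ∈ t
        · obtain ⟨t, rfl⟩ := Multiset.exists_cons_of_mem hI
          obtain ⟨x, s, hx, hst', rfl⟩ := Multiset.rel_cons_right.1 hst
          obtain ⟨b, hb, hbM⟩ := ih ⟨d, s, t, rfl, hd, hst', (Multiset.cons_le_cons_iff _).1 ht⟩
          exact ⟨[x] ++ b, mem_productLang_cons.2 ⟨_, .inr ⟨x, hx, rfl⟩, b, hb, rfl⟩, by
            rw [Multiset.add_cons, ← hbM]; rfl⟩
        · obtain ⟨b, hb, hbM⟩ := ih ⟨d, s, t, rfl, hd, hst, (Multiset.le_cons_of_notMem hI).1 ht⟩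
          exact ⟨[] ++ b, mem_productLang_cons.2 ⟨_, .inl rfl, b, hb, rfl⟩, hbM⟩

theorem mem_productIdeal_iff {P : List (Atom X)} {M : FinMultiset X} :
    M ∈ productIdeal P ↔ Matches (fun x (I : Order.Ideal X) => x ∈ I) (· ∈ starPart P)
      M.toMultiset (idealFactors P) :=
  Iff.trans Iff.rfl exists_perm_mem_productLang_iff

/-- Inclusion of products of atoms up to permutation.  For necessity, test on powers of an element
of the star part, and on a multiset with one generic element from each ideal. -/
theorem productIdeal_subset_iff {P Q : List (Atom X)} :
    (productIdeal P : Set (FinMultiset X)) ⊆ productIdeal Q ↔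
      starPart P ≤ starPart Q ∧
      Matches (fun I J : Order.Ideal X => (I : Set X) ⊆ J)
        (fun I : Order.Ideal X => (I : Set X) ⊆ starPart Q) (idealFactors P) (idealFactors Q) := by
  constructor
  · intro h
    refine ⟨fun x hx => ?_, ?_⟩
    · by_contra hxQ
      -- Outside the star part, each occurrence of `x` needs a factor `I + ε` of its own.
      have hMQ : FinMultiset.ofMultiset (Multiset.replicate ((idealFactors Q).length + 1) x) ∈
          productIdeal Q := h (mem_productIdeal_iff.2
        (Matches.of_forall (fun y hy => Multiset.eq_of_mem_replicate hy ▸ hx) _))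
      have := (mem_productIdeal_iff.1 hMQ).card_le fun y hy => by
        rw [FinMultiset.toMultiset_ofMultiset] at hy
        rwa [Multiset.eq_of_mem_replicate hy]
      rw [FinMultiset.toMultiset_ofMultiset, Multiset.card_replicate, Multiset.coe_card] at this
      omega
    · choose g hg hgen using fun I : Order.Ideal X =>
        I.exists_generic (starPart Q :: (idealFactors Q).map Order.Ideal.toLowerSet)
      have hMQ : FinMultiset.ofMultiset ((idealFactors P : Multiset (Order.Ideal X)).map g) ∈
          productIdeal Q := h <| mem_productIdeal_iff.2 <| by
        rw [FinMultiset.toMultiset_ofMultiset, Matches.map_left]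
        exact ⟨0, _, _, (zero_add _).symm, by simp, Multiset.rel_refl_of_refl_on
          fun I _ => hg I, le_rfl⟩
      rw [mem_productIdeal_iff, FinMultiset.toMultiset_ofMultiset, Matches.map_left] at hMQ
      refine hMQ.mono (fun I _ hI => ?_) fun I _ J hJ hIJ => ?_
      · exact hgen I _ (by simp) hI
      · exact hgen I _ (List.mem_cons_of_mem _ (List.mem_map_of_mem hJ)) hIJ
  · rintro ⟨hD, h⟩ M hM
    exact mem_productIdeal_iff.2 ((mem_productIdeal_iff.1 hM).comp h (fun x hx => hD hx)
      (fun x I hx hI => hI hx) fun x I J hx hIJ => hIJ hx)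

theorem starPart_map_opt (l : List (Order.Ideal X)) : starPart (l.map Atom.opt) = ⊥ := by
  simp [starPart]

theorem idealFactors_map_opt (l : List (Order.Ideal X)) :
    idealFactors (l.map Atom.opt) = l := by
  simp [idealFactors, List.filterMap_map]

theorem productIdeal_map_principal (w : List X) :
    productIdeal (w.map fun x => Atom.opt (Order.Ideal.principal x)) =
      Order.Ideal.principal (FinMultiset.ofList w) := by
  have hw : (w.map fun x => Atom.opt (Order.Ideal.principal x)) =
      (w.map Order.Ideal.principal).map Atom.opt := by simp
  ext M
  rw [hw, SetLike.mem_coe, SetLike.mem_coe, mem_productIdeal_iff, Order.Ideal.mem_principal,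
    FinMultiset.le_iff, starPart_map_opt, idealFactors_map_opt, ← Multiset.map_coe,
    Matches.map_right]
  rfl

/-! ### Every ideal of multisets is the closure of a product of atoms -/

theorem Order.Ideal.exists_forall_le (I : Order.Ideal X) {l : List X} (hl : ∀ x ∈ l, x ∈ I) :
    ∃ z ∈ I, ∀ x ∈ l, x ≤ z := by
  induction l with
  | nil =>
    obtain ⟨x, hx⟩ := I.nonempty
    exact ⟨x, hx, by simp⟩
  | cons x l ih =>
    simp only [List.mem_cons, forall_eq_or_imp] at hl ⊢
    obtain ⟨y, hy, hly⟩ := ih hl.2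
    obtain ⟨z, hz, hxz, hyz⟩ := I.directed x hl.1 y hy
    exact ⟨z, hz, hxz, fun w hw => (hly w hw).trans hyz⟩

/-- The only ideals of a finite power are the products of ideals. -/
theorem Order.Ideal.exists_mem_pi_iff {p : ℕ} (I : Order.Ideal (Fin p → X)) :
    ∃ J : Fin p → Order.Ideal X, ∀ t, t ∈ I ↔ ∀ i, t i ∈ J i := by
  refine ⟨fun i =>
    { carrier := {x | ∃ t ∈ I, x ≤ t i}
      lower' := fun x y hxy ⟨t, ht, hx⟩ => ⟨t, ht, hxy.trans hx⟩
      nonempty' := I.nonempty.imp' (fun t => t i) fun t ht => ⟨t, ht, le_rfl⟩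
      directed' := ?_ }, fun t => ⟨fun ht i => ⟨t, ht, le_rfl⟩, fun h => ?_⟩⟩
  · rintro x ⟨s, hs, hx⟩ y ⟨t, ht, hy⟩
    obtain ⟨r, hr, hsr, htr⟩ := I.directed s hs t ht
    exact ⟨r i, ⟨r, hr, le_rfl⟩, hx.trans (hsr i), hy.trans (htr i)⟩
  · choose s hs hts using h
    obtain ⟨r, hr, hsr⟩ := I.exists_forall_le (l := List.ofFn s) (by simpa using hs)
    simp only [List.forall_mem_ofFn_iff] at hsr
    exact I.lower (fun i => (hts i).trans (hsr i i)) hr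

open FinMultiset in
/-- In an ideal `J` of multisets over a well-quasi-ordering, let `D` be the set of the elements
that can be added without leaving `J`.  Some `M₀ ∈ J` witnesses that no other element can be
added, so every element of `J` lies below some `t + R ∈ J` with `R ⊆ D` and `|t| = |M₀|`.
The possible `t` form a lower set in a finite power of `X`, a finite union of products of ideals;
each of these gives a product of atoms inside `J`, together they cover `J`, hence one of them
is all of `J`. -/
theorem exists_productIdeal_eq [WellQuasiOrderedLE X] (J : Order.Ideal (FinMultiset X)) :
    ∃ (D : LowerSet X) (l : List (Order.Ideal X)),
      J = productIdeal (.star D :: l.map Atom.opt) := by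
  let D : LowerSet X := ⟨{x | ∀ M, ofMultiset M ∈ J → ofMultiset (x ::ₘ M) ∈ J},
    fun x y hyx hx M hM => J.lower (le_iff.2 (Matches.pair hyx (le_iff.1 le_rfl))) (hx M hM)⟩
  have add_mem : ∀ d M, (∀ x ∈ d, x ∈ D) → ofMultiset M ∈ J → ofMultiset (M + d) ∈ J := by
    intro d M hd hM
    induction d using Multiset.induction_on with
    | empty => simpa using hM
    | cons x d ih =>
      rw [Multiset.add_cons]
      exact hd x (Multiset.mem_cons_self _ _) _ (ih fun y hy => hd y (Multiset.mem_cons_of_mem hy))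
  obtain ⟨M₀, hM₀, hmax⟩ : ∃ M, ofMultiset M ∈ J ∧ ∀ x, ofMultiset (x ::ₘ M) ∈ J → x ∈ D := by
    -- It suffices to rule out the finitely many minimal elements outside `D`, each by a multiset of
    -- its own, and to take an upper bound of these in `J`.
    obtain ⟨l, hl⟩ := D.compl.exists_basis
    have hw : ∀ x, ∃ M, ofMultiset M ∈ J ∧ (x ∉ D → ofMultiset (x ::ₘ M) ∉ J) := by
      intro x
      by_cases hx : x ∈ D
      · obtain ⟨M, hM⟩ := J.nonempty
        exact ⟨M, hM, fun h => absurd hx h⟩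
      · have : ¬ ∀ M, ofMultiset M ∈ J → ofMultiset (x ::ₘ M) ∈ J := hx
        push Not at this
        obtain ⟨M, hM, hxM⟩ := this
        exact ⟨M, hM, fun _ => hxM⟩
    choose m hm hm' using hw
    obtain ⟨N, hN, hmN⟩ := J.exists_forall_le (l := l.map fun x => ofMultiset (m x)) <| by
      simpa using fun x _ => hm x
    refine ⟨N.toMultiset, hN, fun x hx => ?_⟩
    by_contra hxD
    obtain ⟨y, hy, hyx⟩ := (hl x).1 hxD
    exact hm' y ((hl y).2 ⟨y, hy, le_rfl⟩) (J.lower (le_iff.2 (Matches.pair hyx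
      (le_iff.1 (hmN _ (List.mem_map_of_mem hy))))) hx)
  obtain ⟨p, hp⟩ : ∃ p, Multiset.card M₀ = p := ⟨_, rfl⟩
  have hcov : ∀ N ∈ J, ∃ (t : Fin p → X) (R : Multiset X), (∀ x ∈ R, x ∈ D) ∧
      ofMultiset (List.ofFn t) ∈ J ∧
      N ≤ ofMultiset (((List.ofFn t : List X) : Multiset X) + R) := by
    intro N hN
    obtain ⟨K, hK, hMK, hNK⟩ := J.directed _ hM₀ N hN
    obtain ⟨d, s, t, hMs, hd, hst, ht⟩ := le_iff.1 hMK
    obtain rfl : d = 0 := Multiset.eq_zero_of_forall_notMem hd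
    rw [toMultiset_ofMultiset, zero_add] at hMs
    subst hMs
    obtain ⟨R, hR⟩ := Multiset.le_iff_exists_add.1 ht
    have hlen : t.toList.length = p := by
      rw [Multiset.length_toList, ← Multiset.card_eq_card_of_rel hst, hp]
    obtain ⟨f, hf⟩ : ∃ f : Fin p → X, ((List.ofFn f : List X) : Multiset X) = t := by
      subst hlen
      exact ⟨t.toList.get, by rw [List.ofFn_get, Multiset.coe_toList]⟩
    refine ⟨f, R, fun x hx => hmax x ?_, J.lower ?_ hK, ?_⟩
    · obtain ⟨R, rfl⟩ := Multiset.exists_cons_of_mem hx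
      refine J.lower (le_iff.2 ?_) hK
      rw [hR, Multiset.add_cons]
      exact Matches.pair le_rfl
        ⟨0, M₀, t, (zero_add _).symm, by simp, hst, Multiset.le_add_right _ _⟩
    · exact le_iff.2 (hf ▸ (le_iff.1 (le_refl (ofMultiset t))).mono_right ht)
    · rw [hf, ← hR]
      exact hNK
  let T : LowerSet (Fin p → X) := ⟨{t | ofMultiset (List.ofFn t) ∈ J}, fun s t hts hs => by
    refine J.lower (le_iff.2 ?_) hs
    simp only [toMultiset_ofMultiset, List.ofFn_eq_map, ← Multiset.map_coe]
    rw [Matches.map_left, Matches.map_right]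
    exact ⟨0, _, _, (zero_add _).symm, by simp,
      Multiset.rel_refl_of_refl_on fun i _ => hts i, le_rfl⟩⟩
  obtain ⟨L, hL⟩ := T.exists_ideals
  choose F hF using fun I : Order.Ideal (Fin p → X) => I.exists_mem_pi_iff
  let Q : Order.Ideal (Fin p → X) → Order.Ideal (FinMultiset X) := fun I =>
    productIdeal (.star D :: (List.ofFn (F I)).map Atom.opt)
  have hQ : ∀ I M, M ∈ Q I ↔ Matches (fun x i => x ∈ F I i) (· ∈ D) M.toMultiset
      (List.finRange p) := by
    intro I M
    simp only [Q, mem_productIdeal_iff, idealFactors_cons_star, idealFactors_map_opt,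
      mem_starPart_cons_star, starPart_map_opt, LowerSet.notMem_bot, or_false,
      List.ofFn_eq_map, ← Multiset.map_coe, Matches.map_right]
  obtain ⟨K, hK, hJK⟩ := Order.Ideal.exists_subset_of_forall_exists (I := J) (l := L.map Q) <| by
    intro N hN
    obtain ⟨t, R, hR, htJ, hle⟩ := hcov N hN
    obtain ⟨I, hI, htI⟩ := (hL t).1 htJ
    refine ⟨Q I, List.mem_map_of_mem hI, (Q I).lower hle ((hQ _ _).2 ?_)⟩
    rw [toMultiset_ofMultiset, List.ofFn_eq_map, ← Multiset.map_coe]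
    refine Matches.add_free (Matches.map_left.2 ?_) hR
    exact ⟨0, _, _, (zero_add _).symm, by simp,
      Multiset.rel_refl_of_refl_on fun i _ => (hF I t).1 htI i, le_rfl⟩
  obtain ⟨I, hI, rfl⟩ := List.mem_map.1 hK
  refine ⟨D, List.ofFn (F I), le_antisymm hJK fun M hM => ?_⟩
  obtain ⟨d, s, t, hMs, hd, hst, ht⟩ := (hQ I M).1 hM
  -- For `Q I ≤ J`, complete the matched part `s` of a member of `Q I` to a member of `T`.
  have htn : t.Nodup := Multiset.nodup_of_le ht (Multiset.coe_nodup.2 (List.nodup_finRange p))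
  obtain ⟨f, hf, hsf⟩ : ∃ f : Fin p → X, (∀ i, f i ∈ F I i) ∧ s = t.map f := by
    clear ht hMs hM
    induction hst with
    | zero =>
      choose f hf using fun i => (F I i).nonempty
      exact ⟨f, hf, rfl⟩
    | @cons x i s t hx _ ih =>
      rw [Multiset.nodup_cons] at htn
      obtain ⟨f, hf, rfl⟩ := ih htn.2
      refine ⟨Function.update f i x, fun j => ?_, ?_⟩
      · by_cases hj : j = i
        · subst hj
          simpa using hx
        · simpa [hj] using hf j
      · rw [Multiset.map_cons, Function.update_self]
        congr 1
        refine Multiset.map_congr rfl fun j hj => ?_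
        rw [Function.update_of_ne]
        rintro rfl
        exact htn.1 hj
  have hfJ : ofMultiset (List.ofFn f) ∈ J := (hL f).2 ⟨I, hI, (hF I f).2 hf⟩
  have hsJ : ofMultiset s ∈ J := by
    refine J.lower (le_iff.2 ((le_iff.1 (le_refl (ofMultiset s))).mono_right ?_)) hfJ
    rw [hsf, List.ofFn_eq_map, toMultiset_ofMultiset, ← Multiset.map_coe]
    exact Multiset.map_le_map ht
  have := add_mem d s hd hsJ
  rwa [add_comm, ← hMs] at this

/-! ### Small bases of the upper sets of multisets -/

open FinMultiset in
/-- If rounding down by `f` does not create new memberships in the ideals that occur in `P`, then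
each multiset outside the ideal of `P` lies above one outside it that consists of at most
`|idealFactors P| + 1` rounded elements.  Before rounding, take a minimal submultiset outside the
ideal: deleting one element leaves only elements that need a factor `I + ε` each. -/
theorem exists_small_notMem_productIdeal {P : List (Atom X)} {f : X → X} (hf : ∀ y, f y ≤ y)
    (hD : ∀ y, f y ∈ starPart P → y ∈ starPart P)
    (hI : ∀ y, ∀ I ∈ idealFactors P, f y ∈ I → y ∈ I) {M : FinMultiset X}
    (hM : M ∉ productIdeal P) :
    ∃ S : Multiset X, Multiset.card S ≤ (idealFactors P).length + 1 ∧
      ofMultiset (S.map f) ≤ M ∧ ofMultiset (S.map f) ∉ productIdeal P := by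
  classical
  obtain ⟨S, hSM, hS, hcard⟩ : ∃ S ≤ M.toMultiset, ofMultiset S ∉ productIdeal P ∧
      Multiset.card S ≤ (idealFactors P).length + 1 := by
    obtain ⟨N, hN⟩ : ∃ N, M.toMultiset = N := ⟨_, rfl⟩
    replace hM : ofMultiset N ∉ productIdeal P := hN ▸ hM
    rw [hN]
    clear hN M
    induction N using Multiset.strongInductionOn with
    | ih N ih =>
    by_cases h : ∃ x ∈ N, ofMultiset (N.erase x) ∉ productIdeal P
    · obtain ⟨x, hx, hxN⟩ := h
      obtain ⟨S, hS, h⟩ := ih _ (Multiset.erase_lt.2 hx) hxN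
      exact ⟨S, hS.trans (Multiset.erase_le _ _), h⟩
    · push Not at h
      refine ⟨N, le_rfl, hM, ?_⟩
      rcases Multiset.empty_or_exists_mem N with rfl | ⟨x, hx⟩
      · simp
      have hND : ∀ y ∈ N, y ∉ starPart P := by
        intro y hy hyD
        refine hM (mem_productIdeal_iff.2 ?_)
        have := (mem_productIdeal_iff.1 (h y hy)).free hyD
        rwa [toMultiset_ofMultiset, Multiset.cons_erase hy] at this
      have hle := (mem_productIdeal_iff.1 (h x hx)).card_le
        fun y hy => hND y (Multiset.mem_of_mem_erase hy)
      rw [toMultiset_ofMultiset, Multiset.card_erase_of_mem hx, Multiset.coe_card] at hle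
      exact Nat.le_add_of_sub_le hle
  refine ⟨S, hcard, le_iff.2 ?_, fun h => hS (mem_productIdeal_iff.2 ?_)⟩
  · rw [toMultiset_ofMultiset, Matches.map_left]
    exact ⟨0, S, S, (zero_add _).symm, by simp,
      Multiset.rel_refl_of_refl_on fun x _ => hf x, hSM⟩
  · rw [mem_productIdeal_iff, toMultiset_ofMultiset, Matches.map_left] at h
    exact h.mono (fun y _ => hD y) fun y _ I hIP => hI y I hIP

open FinMultiset in
/-- If rounding down by `f` stays above the elements of `M` and `N`, then each common upper bound
of `M` and `N` lies above one that consists of at most `|M| + |N|` rounded elements. -/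
theorem exists_small_upper_bound {f : X → X} (hf : ∀ y, f y ≤ y) {M N K : FinMultiset X}
    (hM : ∀ y, ∀ x ∈ M.toMultiset, x ≤ y → x ≤ f y)
    (hN : ∀ y, ∀ x ∈ N.toMultiset, x ≤ y → x ≤ f y) (hMK : M ≤ K) (hNK : N ≤ K) :
    ∃ S : Multiset X, Multiset.card S ≤ Multiset.card M.toMultiset + Multiset.card N.toMultiset ∧
      ofMultiset (S.map f) ≤ K ∧ M ≤ ofMultiset (S.map f) ∧ N ≤ ofMultiset (S.map f) := by
  classical
  have key : ∀ {M : FinMultiset X}, M ≤ K → ∃ t ≤ K.toMultiset,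
      Multiset.Rel (· ≤ ·) M.toMultiset t := by
    intro M hMK
    obtain ⟨d, s, t, hMs, hd, hst, ht⟩ := le_iff.1 hMK
    obtain rfl : d = 0 := Multiset.eq_zero_of_forall_notMem hd
    rw [zero_add] at hMs
    exact ⟨t, ht, hMs ▸ hst⟩
  obtain ⟨s, hsK, hs⟩ := key hMK
  obtain ⟨t, htK, ht⟩ := key hNK
  have above : ∀ {M : FinMultiset X} {s}, (∀ y, ∀ x ∈ M.toMultiset, x ≤ y → x ≤ f y) →
      Multiset.Rel (· ≤ ·) M.toMultiset s → ∀ u, s ≤ u → M ≤ ofMultiset (u.map f) := by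
    intro M s hM hs u hu
    rw [le_iff, toMultiset_ofMultiset, Matches.map_right]
    exact ⟨0, _, s, (zero_add _).symm, by simp, hs.mono fun x hx y _ => hM y x hx, hu⟩
  -- The union of the partners of the elements of `M` and of those of `N`, inside `K`.
  refine ⟨s ∪ t, ?_, ?_, above hM hs _ Multiset.le_union_left,
    above hN ht _ Multiset.le_union_right⟩
  · rw [Multiset.card_eq_card_of_rel hs, Multiset.card_eq_card_of_rel ht, ← Multiset.card_add]
    exact Multiset.card_le_card (Multiset.union_le_add s t)
  · rw [le_iff, toMultiset_ofMultiset, Matches.map_left]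
    exact ⟨0, _, _, (zero_add _).symm, by simp, Multiset.rel_refl_of_refl_on fun x _ => hf x,
      Multiset.union_le hsK htK⟩

/-! ### Closure of a product of atoms under permutation -/

theorem starPart_permutedProduct (P : List (Atom X))
    (σ : Equiv.Perm (Fin (idealFactors P).length)) :
    starPart (permutedProduct P σ) = starPart P := by
  have h : ∀ A ∈ permutedProduct P σ, ∀ E, A = .star E → E = starPart P := by
    simp [permutedProduct]
    grind
  refine le_antisymm (sSup_le fun E hE => (h _ hE E rfl).le) (le_sSup ?_)
  exact List.mem_cons_self

theorem idealFactors_permutedProduct (P : List (Atom X))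
    (σ : Equiv.Perm (Fin (idealFactors P).length)) :
    (idealFactors (permutedProduct P σ)).Perm (idealFactors P) := by
  have h : ∀ l : List (Fin (idealFactors P).length),
      idealFactors (l.flatMap fun i => [Atom.opt ((idealFactors P).get (σ i)),
        Atom.star (starPart P)]) = l.map ((idealFactors P).get ∘ σ) := by
    intro l
    induction l with
    | nil => rfl
    | cons i l ih =>
      rw [List.map_cons, ← ih]
      rfl
  rw [permutedProduct, idealFactors_cons_star, h, ← List.ofFn_eq_map]
  simpa using σ.ofFn_comp_perm (idealFactors P).get

/-- A word whose letters can be matched into the factors `I + ε` is read letter by letter: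
unmatched letters belong to the surrounding factor `D*`, a matched letter uses up its factor,
and the remaining factors follow in any order. -/
theorem exists_order_mem_productLang {D : LowerSet X} {ι : Type*} {g : ι → Order.Ideal X}
    {v : List X} {N : Multiset ι} (h : Matches (fun x i => x ∈ g i) (· ∈ D) (v : Multiset X) N) :
    ∃ l : List ι, (l : Multiset ι) = N ∧
      v ∈ productLang (.star D :: l.flatMap fun i => [Atom.opt (g i), .star D]) := by
  induction v generalizing N with
  | nil => exact ⟨N.toList, N.coe_toList, productLang_nil_mem _⟩
  | cons x v ih =>
    rw [← Multiset.cons_coe, Matches.cons_left] at h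
    obtain ⟨hx, h⟩ | ⟨i, N, rfl, hxi, h⟩ := h
    · obtain ⟨l, hl, hv⟩ := ih h
      obtain ⟨a, ha, b, hb, rfl⟩ := mem_productLang_cons.1 hv
      exact ⟨l, hl, mem_productLang_cons.2 ⟨x :: a, by simpa [mem_lang_star] using ⟨hx, ha⟩,
        b, hb, rfl⟩⟩
    · obtain ⟨l, rfl, hv⟩ := ih h
      exact ⟨i :: l, rfl, mem_productLang_cons.2 ⟨[], Atom.nil_mem_lang _, x :: v,
        mem_productLang_cons.2 ⟨[x], .inr ⟨x, hxi, rfl⟩, v, hv, rfl⟩, rfl⟩⟩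

/-- Both sides consist of the words whose letters can be matched into the factors `I + ε`, the
unmatched ones lying in `D`. -/
theorem permClosure_productLang (P : List (Atom X)) :
    permClosure (productLang P) =
      ⋃ σ : Equiv.Perm (Fin (idealFactors P).length), productLang (permutedProduct P σ) := by
  have hperm : ∀ (Q : List (Atom X)) (v : List X), v ∈ permClosure (productLang Q) ↔
      Matches (fun x (I : Order.Ideal X) => x ∈ I) (· ∈ starPart Q) (v : Multiset X)
        (idealFactors Q) := by
    intro Q v
    rw [← exists_perm_mem_productLang_iff]
    simp only [Multiset.coe_eq_coe]
    rfl
  refine Set.ext fun v => Iff.trans (hperm P v) (Iff.trans ?_ Set.mem_iUnion.symm)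
  constructor
  · intro h
    rw [← List.map_get_finRange (idealFactors P), ← Multiset.map_coe, Matches.map_right] at h
    obtain ⟨l, hl, hv⟩ := exists_order_mem_productLang h
    have hl' : l.Perm (List.finRange _) := Multiset.coe_eq_coe.1 hl
    have hlen : l.length = (idealFactors P).length := by simpa using hl'.length_eq
    have hnd : l.Nodup := hl'.nodup_iff.2 (List.nodup_finRange _)
    let σ : Equiv.Perm (Fin (idealFactors P).length) := (finCongr hlen.symm).trans
      (hnd.getEquivOfForallMemList l fun i => hl'.mem_iff.2 (List.mem_finRange i))
    have hσ : l = (List.finRange _).map σ := by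
      refine List.ext_getElem (by simp [hlen]) fun i h1 h2 => ?_
      simp [σ]
    refine ⟨σ, ?_⟩
    rwa [hσ, List.flatMap_map] at hv
  · rintro ⟨σ, hv⟩
    have := (hperm _ v).1 ⟨v, hv, .refl v⟩
    rwa [starPart_permutedProduct,
      Multiset.coe_eq_coe.2 (idealFactors_permutedProduct P σ)] at this

theorem FinMultiset.ofList_le_iff_perm_higman {u v : List X} :
    FinMultiset.ofList u ≤ FinMultiset.ofList v ↔ ∃ w, u.Perm w ∧ HigmanLE w v := by
  constructor
  · rintro ⟨u', v', hu, hv, h⟩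
    obtain ⟨w, hw, hwv⟩ := h.exists_perm (ofList_eq.1 hv)
    exact ⟨w, (ofList_eq.1 hu).symm.trans hw, hwv⟩
  · rintro ⟨w, hw, h⟩
    exact ⟨w, v, ofList_eq.2 hw.symm, rfl, h⟩

theorem FinMultiset.ofList_le_iff_higman_perm {u v : List X} :
    FinMultiset.ofList u ≤ FinMultiset.ofList v ↔ ∃ w, HigmanLE u w ∧ w.Perm v := by
  refine ⟨fun h => ?_, fun ⟨w, h, hw⟩ => ⟨u, w, rfl, ofList_eq.2 hw, h⟩⟩
  obtain ⟨w, hw, h⟩ := ofList_le_iff_perm_higman.1 h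
  obtain ⟨l, hl, hlv⟩ := higmanLE_iff.1 h
  obtain ⟨l', hul, hll⟩ : Relation.Comp (List.Forall₂ (· ≤ ·)) List.Perm u l := by
    rw [List.forall₂_comp_perm_eq_perm_comp_forall₂]
    exact ⟨w, hw, hl⟩
  obtain ⟨r, hr⟩ := hlv.exists_perm_append
  exact ⟨l' ++ r, higmanLE_iff.2 ⟨l', hul, List.sublist_append_left _ _⟩,
    (hll.append_right r).trans hr.symm⟩

end FinMultisets

/-! ### Queries to the algorithms of a presentation -/

section Queries

variable {α : Type*} [Primcodable α]

theorem Primrec.presentation_equivTuple {f : α → Presentation} (hf : Primrec f) :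
    Primrec fun a => Presentation.equivTuple (f a) :=
  (Primrec.of_equiv (e := Presentation.equivTuple)).comp hf

@[fun_prop]
theorem Primrec.presentation_mk
    {c₁ c₂ c₃ c₄ c₅ c₆ c₇ c₈ c₉ : α → Nat.Partrec.Code} {d₁ d₂ : α → List ℕ}
    (h₁ : Primrec c₁) (h₂ : Primrec c₂) (h₃ : Primrec c₃) (h₄ : Primrec c₄) (h₅ : Primrec c₅)
    (h₆ : Primrec c₆) (h₇ : Primrec c₇) (h₈ : Primrec c₈) (h₉ : Primrec c₉)
    (hd₁ : Primrec d₁) (hd₂ : Primrec d₂) :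
    Primrec fun a => (⟨⟨c₁ a, c₂ a, c₃ a, c₄ a, c₅ a, c₆ a, c₇ a, c₈ a, c₉ a⟩, d₁ a, d₂ a⟩ :
      Presentation) :=
  (Primrec.of_equiv_symm (e := Presentation.equivTuple)).comp
    (f := Presentation.equivTuple.symm)
    (g := fun a => ((c₁ a, c₂ a, c₃ a, c₄ a, c₅ a, c₆ a, c₇ a, c₈ a, c₉ a), d₁ a, d₂ a))
    (by fun_prop)

variable {f : α → Presentation}

@[fun_prop]
theorem Primrec.validElem_comp (hf : Primrec f) :
    Primrec fun a => (f a).algorithms.validElem :=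
  (Primrec.presentation_equivTuple hf).fst_comp.fst_comp

@[fun_prop]
theorem Primrec.validIdeal_comp (hf : Primrec f) :
    Primrec fun a => (f a).algorithms.validIdeal :=
  (Primrec.presentation_equivTuple hf).fst_comp.snd_comp.fst_comp

@[fun_prop]
theorem Primrec.elemLE_comp (hf : Primrec f) :
    Primrec fun a => (f a).algorithms.elemLE :=
  (Primrec.presentation_equivTuple hf).fst_comp.snd_comp.snd_comp.fst_comp

@[fun_prop]
theorem Primrec.idealLE_comp (hf : Primrec f) :
    Primrec fun a => (f a).algorithms.idealLE :=
  (Primrec.presentation_equivTuple hf).fst_comp.snd_comp.snd_comp.snd_comp.fst_comp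

@[fun_prop]
theorem Primrec.principal_comp (hf : Primrec f) :
    Primrec fun a => (f a).algorithms.principal :=
  (Primrec.presentation_equivTuple hf).fst_comp.snd_comp.snd_comp.snd_comp.snd_comp.fst_comp

@[fun_prop]
theorem Primrec.interFilter_comp (hf : Primrec f) :
    Primrec fun a => (f a).algorithms.interFilter :=
  (Primrec.presentation_equivTuple hf).fst_comp.snd_comp.snd_comp.snd_comp.snd_comp.snd_comp
    |>.snd_comp.fst_comp

@[fun_prop]
theorem Primrec.complIdeal_comp (hf : Primrec f) :
    Primrec fun a => (f a).algorithms.complIdeal :=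
  (Primrec.presentation_equivTuple hf).fst_comp.snd_comp.snd_comp.snd_comp.snd_comp.snd_comp
    |>.snd_comp.snd_comp.fst_comp

@[fun_prop]
theorem Primrec.idealDecomposition_comp (hf : Primrec f) :
    Primrec fun a => (f a).idealDecomposition :=
  (Primrec.presentation_equivTuple hf).snd_comp.fst_comp

@[fun_prop]
theorem Primrec.filterDecomposition_comp (hf : Primrec f) :
    Primrec fun a => (f a).filterDecomposition :=
  (Primrec.presentation_equivTuple hf).snd_comp.snd_comp

end Queries

namespace Presentation

/-! The following relations hold between representations if the algorithm in question returns
the answer in question.  For correct deciders, positive and negative answers exclude each other;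
both are semidecidable. -/

def LE (P : Presentation) (m n : ℕ) : Prop := 1 ∈ P.algorithms.elemLE.eval (Nat.pair m n)

def NotLE (P : Presentation) (m n : ℕ) : Prop := 0 ∈ P.algorithms.elemLE.eval (Nat.pair m n)

def IdealLE (P : Presentation) (m n : ℕ) : Prop := 1 ∈ P.algorithms.idealLE.eval (Nat.pair m n)

def NotIdealLE (P : Presentation) (m n : ℕ) : Prop :=
  0 ∈ P.algorithms.idealLE.eval (Nat.pair m n)

/-- Membership of an element in an ideal is decided through its principal ideal. -/
def Mem (P : Presentation) (m n : ℕ) : Prop :=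
  ∃ k, k ∈ P.algorithms.principal.eval m ∧ P.IdealLE k n

def NotMem (P : Presentation) (m n : ℕ) : Prop :=
  ∃ k, k ∈ P.algorithms.principal.eval m ∧ P.NotIdealLE k n

def ValidElem (P : Presentation) (n : ℕ) : Prop := 1 ∈ P.algorithms.validElem.eval n

def NotValidElem (P : Presentation) (n : ℕ) : Prop := 0 ∈ P.algorithms.validElem.eval n

def ValidIdeal (P : Presentation) (n : ℕ) : Prop := 1 ∈ P.algorithms.validIdeal.eval n

def NotValidIdeal (P : Presentation) (n : ℕ) : Prop := 0 ∈ P.algorithms.validIdeal.eval n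

def InterFilter (P : Presentation) (m n : ℕ) (l : List ℕ) : Prop :=
  Encodable.encode l ∈ P.algorithms.interFilter.eval (Nat.pair m n)

def ComplIdeal (P : Presentation) (n : ℕ) (l : List ℕ) : Prop :=
  Encodable.encode l ∈ P.algorithms.complIdeal.eval n

/-- The finite set `B` of elements resolves each upper set `↑f` for `f ∈ F`: every element `y`
lies above some `b ∈ B` that belongs to the same members of this family as `y` does.  This is
ensured by closing a basis of the whole set under intersection with the members of the family. -/
def Resolves (P : Presentation) (F : List (List ℕ)) (B : List ℕ) : Prop :=
  (∀ n ∈ P.filterDecomposition, n ∈ B) ∧ ∀ b ∈ B, ∀ f ∈ F,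
    (∃ d ∈ f, P.LE d b) ∨ ∀ d ∈ f, ∃ l, P.InterFilter b d l ∧ ∀ e ∈ l, e ∈ B

/-- `B` resolves the complements of the ideals in `L`. -/
def ResolvesIdeals (P : Presentation) (L B : List ℕ) : Prop :=
  ∃ F, ((∀ J ∈ L, ∃ f ∈ F, P.ComplIdeal J f) ∧ ∀ f ∈ F, ∃ J ∈ L, P.ComplIdeal J f) ∧
    P.Resolves F B

section Semidecidable

variable {α : Type*} [Primcodable α] {P : α → Presentation} {m n : α → ℕ} {l l' : α → List ℕ}
  {F : α → List (List ℕ)}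

@[fun_prop]
theorem semidecidable_LE (hP : Primrec P) (hm : Primrec m) (hn : Primrec n) :
    Semidecidable fun a => (P a).LE (m a) (n a) := by unfold LE; fun_prop

@[fun_prop]
theorem semidecidable_NotLE (hP : Primrec P) (hm : Primrec m) (hn : Primrec n) :
    Semidecidable fun a => (P a).NotLE (m a) (n a) := by unfold NotLE; fun_prop

@[fun_prop]
theorem semidecidable_IdealLE (hP : Primrec P) (hm : Primrec m) (hn : Primrec n) :
    Semidecidable fun a => (P a).IdealLE (m a) (n a) := by unfold IdealLE; fun_prop

@[fun_prop]
theorem semidecidable_NotIdealLE (hP : Primrec P) (hm : Primrec m) (hn : Primrec n) :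
    Semidecidable fun a => (P a).NotIdealLE (m a) (n a) := by unfold NotIdealLE; fun_prop

@[fun_prop]
theorem semidecidable_Mem (hP : Primrec P) (hm : Primrec m) (hn : Primrec n) :
    Semidecidable fun a => (P a).Mem (m a) (n a) := by unfold Mem; fun_prop

@[fun_prop]
theorem semidecidable_NotMem (hP : Primrec P) (hm : Primrec m) (hn : Primrec n) :
    Semidecidable fun a => (P a).NotMem (m a) (n a) := by unfold NotMem; fun_prop

@[fun_prop]
theorem semidecidable_ValidElem (hP : Primrec P) (hn : Primrec n) :
    Semidecidable fun a => (P a).ValidElem (n a) := by unfold ValidElem; fun_prop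

@[fun_prop]
theorem semidecidable_NotValidElem (hP : Primrec P) (hn : Primrec n) :
    Semidecidable fun a => (P a).NotValidElem (n a) := by unfold NotValidElem; fun_prop

@[fun_prop]
theorem semidecidable_ValidIdeal (hP : Primrec P) (hn : Primrec n) :
    Semidecidable fun a => (P a).ValidIdeal (n a) := by unfold ValidIdeal; fun_prop

@[fun_prop]
theorem semidecidable_NotValidIdeal (hP : Primrec P) (hn : Primrec n) :
    Semidecidable fun a => (P a).NotValidIdeal (n a) := by unfold NotValidIdeal; fun_prop

@[fun_prop]
theorem semidecidable_InterFilter (hP : Primrec P) (hm : Primrec m) (hn : Primrec n)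
    (hl : Primrec l) : Semidecidable fun a => (P a).InterFilter (m a) (n a) (l a) := by
  unfold InterFilter; fun_prop

@[fun_prop]
theorem semidecidable_ComplIdeal (hP : Primrec P) (hn : Primrec n) (hl : Primrec l) :
    Semidecidable fun a => (P a).ComplIdeal (n a) (l a) := by unfold ComplIdeal; fun_prop

@[fun_prop]
theorem semidecidable_Resolves (hP : Primrec P) (hF : Primrec F) (hl : Primrec l) :
    Semidecidable fun a => (P a).Resolves (F a) (l a) := by unfold Resolves; fun_prop

@[fun_prop]
theorem semidecidable_ResolvesIdeals (hP : Primrec P) (hl : Primrec l) (hl' : Primrec l') :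
    Semidecidable fun a => (P a).ResolvesIdeals (l a) (l' a) := by
  unfold ResolvesIdeals; fun_prop

end Semidecidable

theorem one_mem_truthValue {p : Prop} : 1 ∈ Part.some (truthValue p) ↔ p := by
  by_cases h : p <;> simp [truthValue, h]

theorem zero_mem_truthValue {p : Prop} : 0 ∈ Part.some (truthValue p) ↔ ¬ p := by
  by_cases h : p <;> simp [truthValue, h]

/-- The deciders and the algorithm for principal ideals of the presentation are correct. -/
structure Decides {X : Type u} [Preorder X] (P : Presentation) (ρX : Naming X)
    (ρI : Naming (Order.Ideal X)) : Prop where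
  elems : IsDataStructure ρX P.algorithms.validElem
  ideals : IsDataStructure ρI P.algorithms.validIdeal
  elemLE : ∀ m n x y, ρX m = some x → ρX n = some y →
    P.algorithms.elemLE.eval (Nat.pair m n) = Part.some (truthValue (x ≤ y))
  idealLE : ∀ m n I J, ρI m = some I → ρI n = some J →
    P.algorithms.idealLE.eval (Nat.pair m n) = Part.some (truthValue ((I : Set X) ⊆ J))
  principal : ∀ n x, ρX n = some x →
    ∃ k, P.algorithms.principal.eval n = Part.some k ∧ ρI k = some (Order.Ideal.principal x)

/-- Moreover, the algorithms that return upper sets are correct. -/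
structure ComputesUpperSets {X : Type u} [Preorder X] (P : Presentation) (ρX : Naming X)
    (ρI : Naming (Order.Ideal X)) : Prop extends P.Decides ρX ρI where
  interFilter : ∀ m n x y, ρX m = some x → ρX n = some y →
    ReturnsList P.algorithms.interFilter (Nat.pair m n)
      fun l => RepresentsUp ρX l (Set.Ici x ∩ Set.Ici y)
  complIdeal : ∀ n I, ρI n = some I →
    ReturnsList P.algorithms.complIdeal n fun l => RepresentsUp ρX l (I : Set X)ᶜ
  filters : RepresentsUp ρX P.filterDecomposition Set.univ

theorem Presents.computesUpperSets {X : Type u} [Preorder X] {P : Presentation} {ρX : Naming X}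
    {ρI : Naming (Order.Ideal X)} (h : P.Presents ρX ρI) : P.ComputesUpperSets ρX ρI where
  elems := h.correct.elems
  ideals := h.correct.ideals
  elemLE := h.correct.elemLE
  idealLE := h.correct.idealLE
  principal := h.correct.principal
  interFilter := h.correct.interFilter
  complIdeal := h.correct.complIdeal
  filters := h.filters

section Soundness

variable {X : Type u} [Preorder X] {P : Presentation} {ρX : Naming X}
  {ρI : Naming (Order.Ideal X)} {m n : ℕ} {x y : X} {I J : Order.Ideal X}

theorem Decides.le_iff (h : P.Decides ρX ρI) (hm : ρX m = some x) (hn : ρX n = some y) :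
    P.LE m n ↔ x ≤ y := by
  rw [LE, h.elemLE m n x y hm hn, one_mem_truthValue]

theorem Decides.notLE_iff (h : P.Decides ρX ρI) (hm : ρX m = some x) (hn : ρX n = some y) :
    P.NotLE m n ↔ ¬ x ≤ y := by
  rw [NotLE, h.elemLE m n x y hm hn, zero_mem_truthValue]

theorem Decides.idealLE_iff (h : P.Decides ρX ρI) (hm : ρI m = some I) (hn : ρI n = some J) :
    P.IdealLE m n ↔ (I : Set X) ⊆ J := by
  rw [IdealLE, h.idealLE m n I J hm hn, one_mem_truthValue]

theorem Decides.notIdealLE_iff (h : P.Decides ρX ρI) (hm : ρI m = some I) (hn : ρI n = some J) :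
    P.NotIdealLE m n ↔ ¬ (I : Set X) ⊆ J := by
  rw [NotIdealLE, h.idealLE m n I J hm hn, zero_mem_truthValue]

theorem principal_subset_iff : ((Order.Ideal.principal x : Order.Ideal X) : Set X) ⊆ I ↔ x ∈ I :=
  Order.Ideal.principal_le_iff

theorem Decides.mem_iff (h : P.Decides ρX ρI) (hm : ρX m = some x) (hn : ρI n = some I) :
    P.Mem m n ↔ x ∈ I := by
  obtain ⟨k, hk, hkx⟩ := h.principal m x hm
  simp only [Mem, hk, Part.mem_some_iff, exists_eq_left, h.idealLE_iff hkx hn,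
    principal_subset_iff]

theorem Decides.notMem_iff (h : P.Decides ρX ρI) (hm : ρX m = some x) (hn : ρI n = some I) :
    P.NotMem m n ↔ x ∉ I := by
  obtain ⟨k, hk, hkx⟩ := h.principal m x hm
  simp only [NotMem, hk, Part.mem_some_iff, exists_eq_left, h.notIdealLE_iff hkx hn,
    principal_subset_iff]

theorem Decides.validElem_iff (h : P.Decides ρX ρI) : P.ValidElem n ↔ ∃ x, ρX n = some x := by
  rw [ValidElem, h.elems.2, one_mem_truthValue, Option.isSome_iff_exists]

theorem Decides.notValidElem_iff (h : P.Decides ρX ρI) :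
    P.NotValidElem n ↔ ¬ ∃ x, ρX n = some x := by
  rw [NotValidElem, h.elems.2, zero_mem_truthValue, Option.isSome_iff_exists]

theorem Decides.validIdeal_iff (h : P.Decides ρX ρI) : P.ValidIdeal n ↔ ∃ I, ρI n = some I := by
  rw [ValidIdeal, h.ideals.2, one_mem_truthValue, Option.isSome_iff_exists]

theorem Decides.notValidIdeal_iff (h : P.Decides ρX ρI) :
    P.NotValidIdeal n ↔ ¬ ∃ I, ρI n = some I := by
  rw [NotValidIdeal, h.ideals.2, zero_mem_truthValue, Option.isSome_iff_exists]

theorem representsUp_iff {l : List ℕ} {U : Set X} : RepresentsUp ρX l U ↔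
    (∀ n ∈ l, ∃ x, ρX n = some x) ∧ ∀ y, y ∈ U ↔ ∃ n ∈ l, ∃ x, ρX n = some x ∧ x ≤ y := by
  rw [RepresentsUp, Set.ext_iff]; rfl

theorem representsDown_iff {l : List ℕ} {D : Set X} : RepresentsDown ρI l D ↔
    (∀ n ∈ l, ∃ I, ρI n = some I) ∧ ∀ x, x ∈ D ↔ ∃ n ∈ l, ∃ I, ρI n = some I ∧ x ∈ I := by
  rw [RepresentsDown, Set.ext_iff]; rfl

theorem ComputesUpperSets.exists_interFilter (h : P.ComputesUpperSets ρX ρI) (hm : ρX m = some x)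
    (hn : ρX n = some y) :
    ∃ l, P.InterFilter m n l ∧ RepresentsUp ρX l (Set.Ici x ∩ Set.Ici y) := by
  obtain ⟨l, hl, hl'⟩ := h.interFilter m n x y hm hn
  exact ⟨l, by rw [InterFilter, hl]; exact Part.mem_some _, hl'⟩

theorem ComputesUpperSets.interFilter_sound (h : P.ComputesUpperSets ρX ρI) (hm : ρX m = some x)
    (hn : ρX n = some y) {l : List ℕ} (hl : P.InterFilter m n l) :
    RepresentsUp ρX l (Set.Ici x ∩ Set.Ici y) := by
  obtain ⟨l', hl', hr⟩ := h.interFilter m n x y hm hn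
  rw [InterFilter, hl', Part.mem_some_iff, Encodable.encode_inj] at hl
  rwa [hl]

theorem ComputesUpperSets.exists_complIdeal (h : P.ComputesUpperSets ρX ρI) (hn : ρI n = some I) :
    ∃ l, P.ComplIdeal n l ∧ RepresentsUp ρX l (I : Set X)ᶜ := by
  obtain ⟨l, hl, hl'⟩ := h.complIdeal n I hn
  exact ⟨l, by rw [ComplIdeal, hl]; exact Part.mem_some _, hl'⟩

theorem ComputesUpperSets.complIdeal_sound (h : P.ComputesUpperSets ρX ρI) (hn : ρI n = some I)
    {l : List ℕ} (hl : P.ComplIdeal n l) : RepresentsUp ρX l (I : Set X)ᶜ := by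
  obtain ⟨l', hl', hr⟩ := h.complIdeal n I hn
  rw [ComplIdeal, hl', Part.mem_some_iff, Encodable.encode_inj] at hl
  rwa [hl]

/-! ### Resolving finitely many upper sets -/

/-- Starting from a basis element below `y`, treat the members `↑f` of the family in turn: if
`y ∈ ↑f` but the current element is not in `↑f`, move on to an element of `B` below `y` that is. -/
theorem ComputesUpperSets.resolves_sound (h : P.ComputesUpperSets ρX ρI) {F : List (List ℕ)}
    {B : List ℕ} (hF : ∀ f ∈ F, ∀ d ∈ f, ∃ x, ρX d = some x) (hB : P.Resolves F B) (y : X) :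
    ∃ b ∈ B, ∃ x, ρX b = some x ∧ x ≤ y ∧ ∀ f ∈ F,
      (∃ d ∈ f, ∃ z, ρX d = some z ∧ z ≤ y) → ∃ d ∈ f, ∃ z, ρX d = some z ∧ z ≤ x := by
  suffices key : ∀ G : List (List ℕ), (∀ f ∈ G, f ∈ F) →
      ∃ b ∈ B, ∃ x, ρX b = some x ∧ x ≤ y ∧ ∀ f ∈ G,
        (∃ d ∈ f, ∃ z, ρX d = some z ∧ z ≤ y) → ∃ d ∈ f, ∃ z, ρX d = some z ∧ z ≤ x from
    key F fun _ => id
  intro G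
  induction G with
  | nil =>
    intro _
    obtain ⟨n, hn, x, hx, hxy⟩ := ((representsUp_iff.1 h.filters).2 y).1 trivial
    exact ⟨n, hB.1 n hn, x, hx, hxy, by simp⟩
  | cons f G ih =>
    intro hG
    simp only [List.mem_cons, forall_eq_or_imp] at hG ⊢
    obtain ⟨b, hb, x, hx, hxy, hbG⟩ := ih hG.2
    by_cases hy : ∃ d ∈ f, ∃ z, ρX d = some z ∧ z ≤ y
    swap
    · exact ⟨b, hb, x, hx, hxy, fun h => absurd h hy, hbG⟩
    obtain ⟨d, hd, z, hz, hzy⟩ := hy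
    rcases hB.2 b hb f hG.1 with ⟨e, he, heb⟩ | hcl
    · obtain ⟨w, hw⟩ := hF f hG.1 e he
      exact ⟨b, hb, x, hx, hxy, fun _ => ⟨e, he, w, hw, (h.le_iff hw hx).1 heb⟩, hbG⟩
    · obtain ⟨l, hl, hlB⟩ := hcl d hd
      obtain ⟨e, he, w, hw, hwy⟩ :=
        ((representsUp_iff.1 (h.interFilter_sound hx hz hl)).2 y).1 ⟨hxy, hzy⟩
      obtain ⟨hxw, hzw⟩ : x ≤ w ∧ z ≤ w :=
        ((representsUp_iff.1 (h.interFilter_sound hx hz hl)).2 w).2 ⟨e, he, w, hw, le_rfl⟩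
      refine ⟨e, hlB e he, w, hw, hwy, fun _ => ⟨d, hd, z, hz, hzw⟩, fun g hg hgy => ?_⟩
      obtain ⟨d', hd', z', hz', hzx⟩ := hbG g hg hgy
      exact ⟨d', hd', z', hz', hzx.trans hxw⟩

/-- A resolving set exists: the process of closing a basis terminates, since each new element
belongs to more members of the family than the element that it comes from. -/
theorem ComputesUpperSets.exists_resolves (h : P.ComputesUpperSets ρX ρI) {F : List (List ℕ)}
    (hF : ∀ f ∈ F, ∀ d ∈ f, ∃ x, ρX d = some x) :
    ∃ B, (∀ b ∈ B, ∃ x, ρX b = some x) ∧ P.Resolves F B := by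
  classical
  let missed : ℕ → Finset (List ℕ) := fun b => F.toFinset.filter fun f => ¬ ∃ d ∈ f, P.LE d b
  suffices key : ∀ (k : ℕ) (L : List ℕ), (∀ b ∈ L, ∃ x, ρX b = some x) →
      (∀ b ∈ L, (missed b).card ≤ k) → ∃ B, (∀ b ∈ L, b ∈ B) ∧ (∀ b ∈ B, ∃ x, ρX b = some x) ∧
        ∀ b ∈ B, ∀ f ∈ F, (∃ d ∈ f, P.LE d b) ∨ ∀ d ∈ f, ∃ l, P.InterFilter b d l ∧
          ∀ e ∈ l, e ∈ B by
    obtain ⟨B, hL, hB, hcl⟩ := key F.toFinset.card P.filterDecomposition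
      (representsUp_iff.1 h.filters).1 fun b _ => Finset.card_filter_le _ _
    exact ⟨B, hB, hL, hcl⟩
  have hmiss : ∀ {b f}, f ∈ F → f ∉ missed b → ∃ d ∈ f, P.LE d b := by
    intro b f hf hfb
    by_contra hcon
    exact hfb (Finset.mem_filter.2 ⟨List.mem_toFinset.2 hf, hcon⟩)
  intro k
  induction k with
  | zero =>
    intro L hL hk
    refine ⟨L, fun _ => id, hL, fun b hb f hf => .inl (hmiss hf ?_)⟩
    rw [Finset.card_eq_zero.1 (Nat.le_zero.1 (hk b hb))]
    exact Finset.notMem_empty f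
  | succ k ih =>
    intro L hL hk
    have hex : ∀ b d, ∃ l, (∃ x, ρX b = some x) → (∃ x, ρX d = some x) → P.InterFilter b d l := by
      intro b d
      by_cases hb : ∃ x, ρX b = some x
      · by_cases hd : ∃ x, ρX d = some x
        · obtain ⟨x, hx⟩ := hb
          obtain ⟨y, hy⟩ := hd
          obtain ⟨l, hl, -⟩ := h.exists_interFilter hx hy
          exact ⟨l, fun _ _ => hl⟩
        · exact ⟨[], fun _ h => absurd h hd⟩
      · exact ⟨[], fun h => absurd h hb⟩
    choose out hout using hex
    let L' := L.flatMap fun b => (F.filter fun f => f ∈ missed b).flatMap fun f =>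
      f.flatMap fun d => out b d
    have hL' : ∀ e ∈ L', ∃ b ∈ L, ∃ f ∈ F, f ∈ missed b ∧ ∃ d ∈ f, e ∈ out b d := by
      intro e he
      simpa [L', and_assoc] using he
    have hnew : ∀ e ∈ L', (∃ x, ρX e = some x) ∧ (missed e).card ≤ k := by
      intro e he
      obtain ⟨b, hb, f, hf, hfb, d, hd, hed⟩ := hL' e he
      obtain ⟨x, hx⟩ := hL b hb
      obtain ⟨z, hz⟩ := hF f hf d hd
      have hr := representsUp_iff.1 (h.interFilter_sound hx hz (hout b d ⟨x, hx⟩ ⟨z, hz⟩))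
      obtain ⟨w, hw⟩ := hr.1 e hed
      obtain ⟨hxw, hzw⟩ : x ≤ w ∧ z ≤ w := (hr.2 w).2 ⟨e, hed, w, hw, le_rfl⟩
      refine ⟨⟨w, hw⟩, Nat.le_of_lt_succ (lt_of_lt_of_le (Finset.card_lt_card ?_) (hk b hb))⟩
      refine Finset.ssubset_iff_subset_ne.2 ⟨fun g hg => ?_, fun heq => ?_⟩
      · simp only [missed, Finset.mem_filter, List.mem_toFinset] at hg ⊢
        refine ⟨hg.1, fun ⟨d', hd', hle⟩ => hg.2 ⟨d', hd', ?_⟩⟩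
        obtain ⟨z', hz'⟩ := hF g hg.1 d' hd'
        exact (h.le_iff hz' hw).2 (((h.le_iff hz' hx).1 hle).trans hxw)
      · rw [← heq] at hfb
        exact (Finset.mem_filter.1 hfb).2 ⟨d, hd, (h.le_iff hz hw).2 hzw⟩
    obtain ⟨B, hLB, hB, hcl⟩ := ih L' (fun e he => (hnew e he).1) fun e he => (hnew e he).2
    refine ⟨L ++ B, fun b hb => List.mem_append_left _ hb, fun b hb => ?_, fun b hb f hf => ?_⟩
    · rcases List.mem_append.1 hb with hb | hb
      exacts [hL b hb, hB b hb]
    · rcases List.mem_append.1 hb with hb | hb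
      · by_cases hfb : f ∈ missed b
        · refine .inr fun d hd => ⟨out b d, hout b d (hL b hb) (hF f hf d hd), fun e he =>
            List.mem_append_right _ (hLB e ?_)⟩
          simp only [L', List.mem_flatMap, List.mem_filter, decide_eq_true_eq]
          exact ⟨b, hb, f, ⟨hf, hfb⟩, d, hd, he⟩
        · exact .inl (hmiss hf hfb)
      · rcases hcl b hb f hf with hle | hcl
        · exact .inl hle
        · refine .inr fun d hd => ?_
          obtain ⟨l, hl, hlB⟩ := hcl d hd
          exact ⟨l, hl, fun e he => List.mem_append_right _ (hlB e he)⟩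

/-- Rounding `y` down to an element of a resolving set creates no new memberships in the ideals. -/
theorem ComputesUpperSets.resolvesIdeals_sound (h : P.ComputesUpperSets ρX ρI) {L B : List ℕ}
    (hL : ∀ n ∈ L, ∃ I, ρI n = some I) (hB : P.ResolvesIdeals L B) (y : X) :
    ∃ b ∈ B, ∃ x, ρX b = some x ∧ x ≤ y ∧ ∀ n ∈ L, ∀ I, ρI n = some I → x ∈ I → y ∈ I := by
  obtain ⟨F, ⟨hLF, hFL⟩, hF⟩ := hB
  obtain ⟨b, hb, x, hx, hxy, hbF⟩ := h.resolves_sound (fun f hf d hd => by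
    obtain ⟨J, hJ, hJf⟩ := hFL f hf
    obtain ⟨I, hI⟩ := hL J hJ
    exact (representsUp_iff.1 (h.complIdeal_sound hI hJf)).1 d hd) hF y
  refine ⟨b, hb, x, hx, hxy, fun n hn I hI hxI => ?_⟩
  by_contra hyI
  obtain ⟨f, hf, hnf⟩ := hLF n hn
  have hr := (representsUp_iff.1 (h.complIdeal_sound hI hnf)).2
  exact (hr x).2 (hbF f hf ((hr y).1 hyI)) hxI

theorem ComputesUpperSets.exists_resolvesIdeals (h : P.ComputesUpperSets ρX ρI) {L : List ℕ}
    (hL : ∀ n ∈ L, ∃ I, ρI n = some I) :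
    ∃ B, (∀ b ∈ B, ∃ x, ρX b = some x) ∧ P.ResolvesIdeals L B := by
  have hF : ∃ F : List (List ℕ), (∀ J ∈ L, ∃ f ∈ F, P.ComplIdeal J f) ∧
      ∀ f ∈ F, ∃ J ∈ L, P.ComplIdeal J f := by
    induction L with
    | nil => exact ⟨[], by simp, by simp⟩
    | cons n L ih =>
      simp only [List.mem_cons, forall_eq_or_imp, exists_eq_or_imp] at hL ⊢
      obtain ⟨⟨I, hI⟩, hL⟩ := hL
      obtain ⟨f, hf, -⟩ := h.exists_complIdeal hI
      obtain ⟨F, hF, hF'⟩ := ih hL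
      exact ⟨f :: F, ⟨⟨f, by simp, hf⟩, fun J hJ => (hF J hJ).imp fun g hg => by simp [hg]⟩, by
        simpa using ⟨.inl hf, fun g hg => .inr (hF' g hg)⟩⟩
  obtain ⟨F, hLF, hFL⟩ := hF
  obtain ⟨B, hB, hR⟩ := h.exists_resolves (F := F) fun f hf d hd => by
    obtain ⟨J, hJ, hJf⟩ := hFL f hf
    obtain ⟨I, hI⟩ := hL J hJ
    exact (representsUp_iff.1 (h.complIdeal_sound hI hJf)).1 d hd
  exact ⟨B, hB, F, ⟨hLF, hFL⟩, hR⟩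

end Soundness

end Presentation

/-! ### Lower sets from upper sets -/

namespace Presentation

/-- A list of ideals that avoid the element `n` represents the complement of the filter of `n` if
a set resolving the complements of these ideals lies in their union and that filter. -/
def ComplFilterSpec (P : Presentation) (n k : ℕ) : Prop :=
  ∃ l : List ℕ, k = Encodable.encode l ∧ (∀ J ∈ l, P.ValidIdeal J ∧ P.NotMem n J) ∧
    ∃ B, P.ResolvesIdeals l B ∧ ∀ b ∈ B, (∃ J ∈ l, P.Mem b J) ∨ P.LE n b

/-- A list of ideals contained in two given ones represents their intersection if a set resolving
the complements of all these ideals lies in the union of the list and the complements of the two. -/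
def InterIdealSpec (P : Presentation) (n k : ℕ) : Prop :=
  ∃ l : List ℕ, k = Encodable.encode l ∧
    (∀ J ∈ l, P.ValidIdeal J ∧ P.IdealLE J n.unpair.1 ∧ P.IdealLE J n.unpair.2) ∧
    ∃ B, P.ResolvesIdeals (n.unpair.1 :: n.unpair.2 :: l) B ∧
      ∀ b ∈ B, (∃ J ∈ l, P.Mem b J) ∨ P.NotMem b n.unpair.1 ∨ P.NotMem b n.unpair.2

section

variable {X : Type u} [Preorder X] {P : Presentation} {ρX : Naming X}
  {ρI : Naming (Order.Ideal X)} {m n k : ℕ} {x : X} {I J : Order.Ideal X}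

theorem ComputesUpperSets.complFilterSpec_sound (h : P.ComputesUpperSets ρX ρI)
    (hn : ρX n = some x) (hk : P.ComplFilterSpec n k) :
    ∃ l : List ℕ, k = Encodable.encode l ∧ RepresentsDown ρI l (Set.Ici x)ᶜ := by
  obtain ⟨l, rfl, hl, B, hB, hcov⟩ := hk
  have hval : ∀ J ∈ l, ∃ I, ρI J = some I := fun J hJ => h.validIdeal_iff.1 (hl J hJ).1
  refine ⟨l, rfl, representsDown_iff.2 ⟨hval, fun y => ⟨fun hy => ?_, ?_⟩⟩⟩
  · obtain ⟨b, hb, z, hz, hzy, hbl⟩ := h.resolvesIdeals_sound hval hB y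
    rcases hcov b hb with ⟨J, hJ, hbJ⟩ | hle
    · obtain ⟨I, hI⟩ := hval J hJ
      exact ⟨J, hJ, I, hI, hbl J hJ I hI ((h.mem_iff hz hI).1 hbJ)⟩
    · exact absurd (((h.le_iff hn hz).1 hle).trans hzy) hy
  · rintro ⟨J, hJ, I, hI, hy⟩ hxy
    exact (h.notMem_iff hn hI).1 (hl J hJ).2 (I.lower hxy hy)

theorem exists_representsDown [WellQuasiOrderedLE X] (hρ : ∀ I, ∃ n, ρI n = some I)
    (D : LowerSet X) : ∃ l, RepresentsDown ρI l (D : Set X) := by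
  obtain ⟨L, hL⟩ := D.exists_ideals
  choose c hc using hρ
  refine ⟨L.map c, representsDown_iff.2 ⟨?_, fun x => ?_⟩⟩
  · simp only [List.mem_map, forall_exists_index, and_imp, forall_apply_eq_imp_iff₂]
    exact fun I _ => ⟨I, hc I⟩
  · rw [SetLike.mem_coe, hL]
    simp [hc]

theorem exists_representsUp [WellQuasiOrderedLE X] (hρ : ∀ x, ∃ n, ρX n = some x)
    (U : UpperSet X) : ∃ l, RepresentsUp ρX l (U : Set X) := by
  obtain ⟨L, hL⟩ := U.exists_basis
  choose c hc using hρ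
  refine ⟨L.map c, representsUp_iff.2 ⟨?_, fun x => ?_⟩⟩
  · simp only [List.mem_map, forall_exists_index, and_imp, forall_apply_eq_imp_iff₂]
    exact fun I _ => ⟨I, hc I⟩
  · rw [SetLike.mem_coe, hL]
    simp [hc]

theorem ComputesUpperSets.exists_complFilterSpec [WellQuasiOrderedLE X]
    (h : P.ComputesUpperSets ρX ρI) (hn : ρX n = some x) : ∃ k, P.ComplFilterSpec n k := by
  obtain ⟨l, hl⟩ := exists_representsDown h.ideals.1 (UpperSet.Ici x).compl
  rw [representsDown_iff] at hl
  obtain ⟨B, hBX, hB⟩ := h.exists_resolvesIdeals hl.1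
  refine ⟨_, l, rfl, fun J hJ => ?_, B, hB, fun b hb => ?_⟩
  · obtain ⟨I, hI⟩ := hl.1 J hJ
    exact ⟨h.validIdeal_iff.2 ⟨I, hI⟩, (h.notMem_iff hn hI).2 fun hx =>
      (hl.2 x).2 ⟨J, hJ, I, hI, hx⟩ le_rfl⟩
  · obtain ⟨z, hz⟩ := hBX b hb
    by_cases hxz : x ≤ z
    · exact .inr ((h.le_iff hn hz).2 hxz)
    · obtain ⟨J, hJ, I, hI, hzI⟩ := (hl.2 z).1 hxz
      exact .inl ⟨J, hJ, (h.mem_iff hz hI).2 hzI⟩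

theorem ComputesUpperSets.interIdealSpec_sound (h : P.ComputesUpperSets ρX ρI)
    (hm : ρI m = some I) (hn : ρI n = some J) (hk : P.InterIdealSpec (Nat.pair m n) k) :
    ∃ l : List ℕ, k = Encodable.encode l ∧ RepresentsDown ρI l ((I : Set X) ∩ J) := by
  obtain ⟨l, rfl, hl, B, hB, hcov⟩ := hk
  simp only [Nat.unpair_pair] at hl hB hcov
  have hval : ∀ K ∈ l, ∃ I, ρI K = some I := fun K hK => h.validIdeal_iff.1 (hl K hK).1
  refine ⟨l, rfl, representsDown_iff.2 ⟨hval, fun y => ⟨fun ⟨hyI, hyJ⟩ => ?_, ?_⟩⟩⟩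
  · obtain ⟨b, hb, z, hz, hzy, hbl⟩ := h.resolvesIdeals_sound
      (by simpa using ⟨⟨I, hm⟩, ⟨J, hn⟩, hval⟩) hB y
    rcases hcov b hb with ⟨K, hK, hbK⟩ | hb | hb
    · obtain ⟨I', hI'⟩ := hval K hK
      exact ⟨K, hK, I', hI', hbl K (by simp [hK]) I' hI' ((h.mem_iff hz hI').1 hbK)⟩
    · exact absurd (I.lower hzy hyI) ((h.notMem_iff hz hm).1 hb)
    · exact absurd (J.lower hzy hyJ) ((h.notMem_iff hz hn).1 hb)
  · rintro ⟨K, hK, I', hI', hy⟩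
    exact ⟨(h.idealLE_iff hI' hm).1 (hl K hK).2.1 hy, (h.idealLE_iff hI' hn).1 (hl K hK).2.2 hy⟩

theorem ComputesUpperSets.exists_interIdealSpec [WellQuasiOrderedLE X]
    (h : P.ComputesUpperSets ρX ρI) (hm : ρI m = some I) (hn : ρI n = some J) :
    ∃ k, P.InterIdealSpec (Nat.pair m n) k := by
  obtain ⟨l, hl⟩ := exists_representsDown h.ideals.1 (I.toLowerSet ⊓ J.toLowerSet)
  rw [representsDown_iff] at hl
  obtain ⟨B, hBX, hB⟩ := h.exists_resolvesIdeals (L := m :: n :: l)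
    (by simpa using ⟨⟨I, hm⟩, ⟨J, hn⟩, hl.1⟩)
  refine ⟨_, l, rfl, ?_, B, by simpa using hB, fun b hb => ?_⟩
  · simp only [Nat.unpair_pair]
    intro K hK
    obtain ⟨I', hI'⟩ := hl.1 K hK
    exact ⟨h.validIdeal_iff.2 ⟨I', hI'⟩,
      (h.idealLE_iff hI' hm).2 fun x hx => ((hl.2 x).2 ⟨K, hK, I', hI', hx⟩).1,
      (h.idealLE_iff hI' hn).2 fun x hx => ((hl.2 x).2 ⟨K, hK, I', hI', hx⟩).2⟩
  · simp only [Nat.unpair_pair]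
    obtain ⟨z, hz⟩ := hBX b hb
    by_cases hzI : z ∈ I
    · by_cases hzJ : z ∈ J
      · obtain ⟨K, hK, I', hI', hzI'⟩ := (hl.2 z).1 ⟨hzI, hzJ⟩
        exact .inl ⟨K, hK, (h.mem_iff hz hI').2 hzI'⟩
      · exact .inr (.inr ((h.notMem_iff hz hn).2 hzJ))
    · exact .inr (.inl ((h.notMem_iff hz hm).2 hzI))

end

/-- In a well-quasi-ordering the operations that return lower sets can be computed uniformly from
the others, by searching for a list of ideals together with a certificate. -/
theorem exists_completion : ∃ G : Presentation → Presentation, Primrec G ∧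
    ∀ (X : Type u) [Preorder X] (P : Presentation) (ρX : Naming X) (ρI : Naming (Order.Ideal X)),
      WellQuasiOrderedLE X → P.ComputesUpperSets ρX ρI →
      RepresentsDown ρI P.idealDecomposition Set.univ → (G P).Presents ρX ρI := by
  obtain ⟨f, hf, hf'⟩ := Semidecidable.exists_codes (R := ComplFilterSpec) (by
    unfold ComplFilterSpec; fun_prop)
  obtain ⟨g, hg, hg'⟩ := Semidecidable.exists_codes (R := InterIdealSpec) (by
    unfold InterIdealSpec; fun_prop)
  refine ⟨fun P => ⟨⟨P.algorithms.validElem, P.algorithms.validIdeal, P.algorithms.elemLE,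
    P.algorithms.idealLE, P.algorithms.principal, f P, P.algorithms.interFilter,
    P.algorithms.complIdeal, g P⟩, P.idealDecomposition, P.filterDecomposition⟩, by fun_prop,
    fun X _ P ρX ρI hX h hdec => ⟨hX, ?_, hdec, h.filters⟩⟩
  exact
    { elems := h.elems
      ideals := h.ideals
      elemLE := h.elemLE
      idealLE := h.idealLE
      principal := h.principal
      complFilter := fun n x hn => by
        obtain ⟨k, hk, hk'⟩ := hf' P n (h.exists_complFilterSpec hn)
        obtain ⟨l, rfl, hl⟩ := h.complFilterSpec_sound hn hk'
        exact ⟨l, hk, hl⟩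
      interFilter := h.interFilter
      complIdeal := h.complIdeal
      interIdeal := fun m n I J hm hn => by
        obtain ⟨k, hk, hk'⟩ := hg' P (Nat.pair m n) (h.exists_interIdealSpec hm hn)
        obtain ⟨l, rfl, hl⟩ := h.interIdealSpec_sound hm hn hk'
        exact ⟨l, hk, hl⟩ }

end Presentation

/-! ### Representations of multisets and of their ideals -/

section Namings

theorem mapM_eq_some_iff {α β : Type*} {f : α → Option β} {l : List α} {m : List β} :
    l.mapM f = some m ↔ List.Forall₂ (fun a b => f a = some b) l m := by
  induction l generalizing m with
  | nil => simp [eq_comm]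
  | cons a l ih =>
    rw [List.mapM_cons]
    cases h : f a with
    | none => simp [List.forall₂_cons_left_iff, h]
    | some b =>
      cases h' : l.mapM f with
      | none =>
        have : ∀ m, ¬ List.Forall₂ (fun a b => f a = some b) l m := fun m hm => by
          simp [← ih, h'] at hm
        simp [List.forall₂_cons_left_iff, this]
      | some m' =>
        simp only [Option.pure_def, Option.bind_eq_bind, Option.bind_some, Option.some.injEq,
          List.forall₂_cons_left_iff, h, ← ih, h']
        constructor
        · rintro rfl
          exact ⟨b, m', rfl, rfl, rfl⟩
        · rintro ⟨b, m, rfl, rfl, rfl⟩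
          rfl

theorem exists_mapM_eq_some_iff {α β : Type*} {f : α → Option β} {l : List α} :
    (∃ m, l.mapM f = some m) ↔ ∀ a ∈ l, ∃ b, f a = some b := by
  simp only [mapM_eq_some_iff]
  induction l with
  | nil => simp
  | cons a l ih =>
    simp only [List.forall₂_cons_left_iff, List.mem_cons, forall_eq_or_imp, ← ih]
    constructor
    · rintro ⟨_, b, m, hb, hm, rfl⟩
      exact ⟨⟨b, hb⟩, m, hm⟩
    · rintro ⟨⟨b, hb⟩, m, hm⟩
      exact ⟨_, b, m, hb, hm, rfl⟩

theorem multisetNaming_encode {X : Type u} {ρX : Naming X} {l : List ℕ} {M : FinMultiset X} :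
    multisetNaming ρX (Encodable.encode l) = some M ↔
      ∃ w, List.Forall₂ (fun n x => ρX n = some x) l w ∧ FinMultiset.ofList w = M := by
  simp [multisetNaming, ← mapM_eq_some_iff]

theorem exists_multisetNaming_encode {X : Type u} {ρX : Naming X} {l : List ℕ} :
    (∃ M : FinMultiset X, multisetNaming ρX (Encodable.encode l) = some M) ↔
      ∀ n ∈ l, ∃ x, ρX n = some x := by
  rw [← exists_mapM_eq_some_iff]
  simp [multisetNaming]

theorem exists_encode_eq {β : Type*} [Denumerable β] (n : ℕ) :
    ∃ l : List β, Encodable.encode l = n :=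
  ⟨Denumerable.ofNat (List β) n, Denumerable.encode_ofNat n⟩

variable {X : Type u} [Preorder X] {ρX : Naming X} {ρI : Naming (Order.Ideal X)}

/-- The representations of ideals that occur in the factors `D*` of a represented product. -/
def starNames (c : List (ℕ ⊕ List ℕ)) : List ℕ := c.flatMap (Sum.elim (fun _ => []) id)

/-- The representations of the ideals `I` in the factors `I + ε` of a represented product. -/
def optNames (c : List (ℕ ⊕ List ℕ)) : List ℕ := c.filterMap (Sum.elim some fun _ => none)

theorem starNames_cons_inl (n : ℕ) (c : List (ℕ ⊕ List ℕ)) :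
    starNames (.inl n :: c) = starNames c := rfl

theorem starNames_cons_inr (l : List ℕ) (c : List (ℕ ⊕ List ℕ)) :
    starNames (.inr l :: c) = l ++ starNames c := rfl

theorem optNames_cons_inl (n : ℕ) (c : List (ℕ ⊕ List ℕ)) :
    optNames (.inl n :: c) = n :: optNames c := rfl

theorem optNames_cons_inr (l : List ℕ) (c : List (ℕ ⊕ List ℕ)) :
    optNames (.inr l :: c) = optNames c := rfl

@[fun_prop]
theorem Primrec.starNames_comp {α : Type*} [Primcodable α] {c : α → List (ℕ ⊕ List ℕ)}
    (hc : Primrec c) : Primrec fun a => starNames (c a) := by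
  unfold starNames
  refine Primrec.listFlatMap_comp hc (Primrec.sumElim_comp ?_ ?_ ?_) <;> fun_prop

@[fun_prop]
theorem Primrec.optNames_comp {α : Type*} [Primcodable α] {c : α → List (ℕ ⊕ List ℕ)}
    (hc : Primrec c) : Primrec fun a => optNames (c a) := by
  unfold optNames
  refine Primrec.listFilterMap_comp hc (Primrec.sumElim_comp ?_ ?_ ?_) <;> fun_prop

theorem mem_unionOfIdeals {l : List (Order.Ideal X)} {x : X} :
    x ∈ unionOfIdeals l ↔ ∃ I ∈ l, x ∈ I := by
  rw [unionOfIdeals, LowerSet.mem_sSup_iff]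
  constructor
  · rintro ⟨_, ⟨I, hI, rfl⟩, hx⟩
    exact ⟨I, hI, hx⟩
  · rintro ⟨I, hI, hx⟩
    exact ⟨_, ⟨I, hI, rfl⟩, hx⟩

theorem exists_mem_ideals_iff {l : List ℕ} {Is : List (Order.Ideal X)}
    (h : List.Forall₂ (fun n I => ρI n = some I) l Is) {p : Order.Ideal X → Prop} :
    (∃ I ∈ Is, p I) ↔ ∃ n ∈ l, ∃ I, ρI n = some I ∧ p I := by
  induction h with
  | nil => simp
  | cons hab _ ih => simp [ih, hab]

/-- What a represented product of atoms denotes, in terms of `starNames` and `optNames`. -/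
theorem mapM_atomOfCode {c : List (ℕ ⊕ List ℕ)} {Q : List (Atom X)}
    (h : c.mapM (atomOfCode ρI) = some Q) :
    RepresentsDown ρI (starNames c) (starPart Q : Set X) ∧
      List.Forall₂ (fun n I => ρI n = some I) (optNames c) (idealFactors Q) := by
  rw [mapM_eq_some_iff] at h
  rw [Presentation.representsDown_iff]
  induction h with
  | nil => simp [starNames, optNames, starPart, idealFactors]
  | @cons a A c Q ha _ ih =>
    cases a with
    | inl n =>
      obtain ⟨I, hI, rfl⟩ := Option.map_eq_some_iff.1 ha
      rw [starPart_cons_opt, starNames_cons_inl, idealFactors_cons_opt, optNames_cons_inl]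
      exact ⟨ih.1, .cons hI ih.2⟩
    | inr l =>
      obtain ⟨Is, hIs, rfl⟩ := Option.map_eq_some_iff.1 ha
      rw [starNames_cons_inr, idealFactors_cons_star, optNames_cons_inr]
      refine ⟨⟨fun n hn => ?_, fun x => ?_⟩, ih.2⟩
      · rcases List.mem_append.1 hn with hn | hn
        exacts [exists_mapM_eq_some_iff.1 ⟨Is, hIs⟩ n hn, ih.1.1 n hn]
      · have := exists_mem_ideals_iff (mapM_eq_some_iff.1 hIs) (p := fun I => x ∈ I)
        rw [SetLike.mem_coe, mem_starPart_cons_star, mem_unionOfIdeals, this,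
          ← SetLike.mem_coe (p := starPart _), ih.1.2]
        simp only [List.mem_append, or_and_right, exists_or]

theorem exists_mapM_atomOfCode {c : List (ℕ ⊕ List ℕ)} :
    (∃ Q, c.mapM (atomOfCode ρI) = some Q) ↔
      ∀ n ∈ starNames c ++ optNames c, ∃ I, ρI n = some I := by
  rw [exists_mapM_eq_some_iff]
  induction c with
  | nil => simp [starNames, optNames]
  | cons a c ih =>
    cases a with
    | inl n =>
      rw [starNames_cons_inl, optNames_cons_inl, List.forall_mem_cons, ih]
      have : (∃ A, atomOfCode ρI (.inl n) = some A) ↔ ∃ I, ρI n = some I := by simp [atomOfCode]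
      rw [this]
      simp only [List.mem_append, List.mem_cons, or_imp, forall_and, forall_eq]
      tauto
    | inr l =>
      rw [starNames_cons_inr, optNames_cons_inr, List.forall_mem_cons, ih]
      have : (∃ A, atomOfCode ρI (.inr l) = some A) ↔ ∀ n ∈ l, ∃ I, ρI n = some I := by
        rw [← exists_mapM_eq_some_iff]
        simp [atomOfCode]
      rw [this]
      simp only [List.mem_append]
      grind

theorem multisetIdealNaming_encode {c : List (ℕ ⊕ List ℕ)} {J : Order.Ideal (FinMultiset X)} :
    multisetIdealNaming ρI (Encodable.encode c) = some J ↔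
      ∃ Q, c.mapM (atomOfCode ρI) = some Q ∧ productIdeal Q = J := by
  simp [multisetIdealNaming]

theorem exists_multisetIdealNaming_encode {c : List (ℕ ⊕ List ℕ)} :
    (∃ J, multisetIdealNaming ρI (Encodable.encode c) = some J) ↔
      ∀ n ∈ starNames c ++ optNames c, ∃ I, ρI n = some I := by
  rw [← exists_mapM_atomOfCode]
  simp [multisetIdealNaming]

theorem exists_multisetNaming_eq {X : Type u} {ρX : Naming X} (hρ : ∀ x, ∃ n, ρX n = some x)
    (M : FinMultiset X) : ∃ n, multisetNaming ρX n = some M := by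
  obtain ⟨w, rfl⟩ := M.exists_ofList
  choose c hc using hρ
  exact ⟨Encodable.encode (w.map c), multisetNaming_encode.2 ⟨w,
    List.forall₂_map_left_iff.2 (List.forall₂_same.2 fun x _ => hc x), rfl⟩⟩

/-- Surjectivity of the representation of ideals by products of atoms. -/
theorem exists_multisetIdealNaming_eq [WellQuasiOrderedLE X] (hρ : ∀ I, ∃ n, ρI n = some I)
    (J : Order.Ideal (FinMultiset X)) : ∃ n, multisetIdealNaming ρI n = some J := by
  obtain ⟨D, l, rfl⟩ := exists_productIdeal_eq J
  obtain ⟨L, hL⟩ := D.exists_ideals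
  choose c hc using hρ
  have hD : D = unionOfIdeals L := SetLike.ext fun x => by rw [hL, mem_unionOfIdeals]
  refine ⟨Encodable.encode (.inr (L.map c) :: l.map fun I => .inl (c I)),
    multisetIdealNaming_encode.2 ⟨_, mapM_eq_some_iff.2 (.cons ?_ ?_), rfl⟩⟩
  · rw [hD, atomOfCode, (mapM_eq_some_iff (m := L)).2]
    · rfl
    · exact List.forall₂_map_left_iff.2 (List.forall₂_same.2 fun I _ => hc I)
  · rw [List.forall₂_map_left_iff, List.forall₂_map_right_iff]
    exact List.forall₂_same.2 fun I _ => by simp [atomOfCode, hc]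

end Namings

/-! ### Deciding matchings of lists of representations -/

/-- All ways to assign to each entry of `l` either no partner or one from `l'`. -/
def assignments (l l' : List ℕ) : List (List (ℕ × Option ℕ)) :=
  (l.map fun a => (none :: l'.map some).map fun o => (a, o)).sections

@[fun_prop]
theorem Primrec.assignments_comp {α : Type*} [Primcodable α] {l l' : α → List ℕ}
    (hl : Primrec l) (hl' : Primrec l') : Primrec fun a => assignments (l a) (l' a) := by
  unfold assignments
  fun_prop

theorem mem_assignments {l l' : List ℕ} {s : List (ℕ × Option ℕ)} :
    s ∈ assignments l l' ↔ s.map Prod.fst = l ∧ ∀ j ∈ s.filterMap Prod.snd, j ∈ l' := by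
  rw [assignments, List.mem_sections]
  induction s generalizing l with
  | nil => cases l <;> simp
  | cons p s ih =>
    cases l with
    | nil => simp
    | cons a l =>
      obtain ⟨b, o⟩ := p
      rw [List.map_cons, List.forall₂_cons, ih]
      cases o <;> simp [and_assoc, eq_comm]
      grind

/-- A matching is an assignment that uses no partner too often; since there are finitely many
assignments, both this and its negation are semidecidable for decidable `R` and `D`. -/
theorem matches_iff_exists_assignment {R : ℕ → ℕ → Prop} {D : ℕ → Prop} {l l' : List ℕ} :
    Matches R D (l : Multiset ℕ) (l' : Multiset ℕ) ↔
      ∃ s ∈ assignments l l', (s.filterMap Prod.snd).Subperm l' ∧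
        ∀ p ∈ s, (p.2 = none ∧ D p.1) ∨ ∃ j, p.2 = some j ∧ R p.1 j := by
  have key : Matches R D (l : Multiset ℕ) (l' : Multiset ℕ) ↔ ∃ s : List (ℕ × Option ℕ),
      s.map Prod.fst = l ∧ ((s.filterMap Prod.snd : List ℕ) : Multiset ℕ) ≤ l' ∧
        ∀ p ∈ s, (p.2 = none ∧ D p.1) ∨ ∃ j, p.2 = some j ∧ R p.1 j := by
    generalize (l' : Multiset ℕ) = N
    constructor
    · intro h
      induction l generalizing N with
      | nil => exact ⟨[], rfl, by simp, by simp⟩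
      | cons a l ih =>
        rw [← Multiset.cons_coe, Matches.cons_left] at h
        rcases h with ⟨ha, h⟩ | ⟨b, N, rfl, hab, h⟩
        · obtain ⟨s, rfl, hs, hs'⟩ := ih N h
          exact ⟨(a, none) :: s, rfl, by simpa using hs, by simpa using ⟨ha, by simpa using hs'⟩⟩
        · obtain ⟨s, rfl, hs, hs'⟩ := ih N h
          refine ⟨(a, some b) :: s, rfl, ?_, by simpa using ⟨hab, by simpa using hs'⟩⟩
          rw [List.filterMap_cons_some (f := Prod.snd) rfl, ← Multiset.cons_coe]
          exact Multiset.cons_le_cons _ hs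
    · rintro ⟨s, rfl, hs, hs'⟩
      induction s generalizing N with
      | nil => exact Matches.zero_left _ _ _
      | cons p s ih =>
        obtain ⟨a, o⟩ := p
        rw [List.forall_mem_cons] at hs'
        rw [List.map_cons, ← Multiset.cons_coe]
        obtain ⟨⟨rfl, ha⟩ | ⟨b, rfl, hab⟩, hs'⟩ := hs'
        · exact (ih N (by simpa using hs) hs').free ha
        · rw [List.filterMap_cons_some (f := Prod.snd) rfl, ← Multiset.cons_coe] at hs
          obtain ⟨N, rfl⟩ := Multiset.exists_cons_of_mem
            (Multiset.mem_of_le hs (Multiset.mem_cons_self _ _))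
          exact (ih N ((Multiset.cons_le_cons_iff _).1 hs) hs').pair hab
  rw [key]
  simp only [Multiset.coe_le, mem_assignments]
  constructor
  · rintro ⟨s, h1, h2, h3⟩
    exact ⟨s, ⟨h1, fun j hj => h2.subset hj⟩, h2, h3⟩
  · rintro ⟨s, ⟨h1, -⟩, h2, h3⟩
    exact ⟨s, h1, h2, h3⟩

theorem Matches.of_forall₂ {α β : Type*} {R : α → β → Prop} (D : α → Prop) {l : List α}
    {m : List β} (h : List.Forall₂ R l m) : Matches R D (l : Multiset α) (m : Multiset β) := by
  induction h with
  | nil => exact Matches.zero_left _ _ _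
  | cons hab _ ih => exact ih.pair hab

/-- Matchings may be computed on representations. -/
theorem Matches.congr_of_forall₂ {α β α' β' : Type*} {R : α → β → Prop} {D : α → Prop}
    {R' : α' → β' → Prop} {D' : α' → Prop} {S : α → α' → Prop} {T : β → β' → Prop}
    {l : List α} {l' : List α'} {m : List β} {m' : List β'} (hl : List.Forall₂ S l l')
    (hm : List.Forall₂ T m m') (hD : ∀ a a', S a a' → (D a ↔ D' a'))
    (hR : ∀ a a' b b', S a a' → T b b' → (R a b ↔ R' a' b')) :
    Matches R D (l : Multiset α) (m : Multiset β) ↔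
      Matches R' D' (l' : Multiset α') (m' : Multiset β') := by
  constructor
  · intro h
    have h1 := (of_forall₂ (fun _ => False) hl.flip).comp h
      (T := fun a' b => ∃ a, S a a' ∧ R a b) (F := D')
      (fun _ => False.elim) (fun a' a ha => (hD a a' ha).1) fun a' a b ha hab => ⟨a, ha, hab⟩
    exact h1.comp (of_forall₂ (fun _ => False) hm) (fun _ => id) (fun _ _ _ => False.elim)
      fun a' b b' ⟨a, ha, hab⟩ hb => (hR a a' b b' ha hb).1 hab
  · intro h
    have h1 := (of_forall₂ (fun _ => False) hl).comp h
      (T := fun a b' => ∃ a', S a a' ∧ R' a' b') (F := D)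
      (fun _ => False.elim) (fun a a' ha => (hD a a' ha).2) fun a a' b' ha hab => ⟨a', ha, hab⟩
    exact h1.comp (of_forall₂ (fun _ => False) hm.flip) (fun _ => id) (fun _ _ _ => False.elim)
      fun a b' b ⟨a', ha, hab⟩ hb => (hR a a' b b' ha hb).2 hab

/-! ### Deciders for multisets -/

namespace MultisetPresentation

open Presentation

/-- A decision as the choice between two semidecidable alternatives. -/
theorem eq_truthValue_iff {p A B : Prop} (hA : A ↔ p) (hB : B ↔ ¬ p) {b : ℕ} :
    (b = 1 ∧ A) ∨ (b = 0 ∧ B) ↔ b = truthValue p := by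
  rw [hA, hB]
  by_cases h : p <;> simp [truthValue, h]

/-- `b` is the answer to whether `n` represents a multiset: all entries represent elements. -/
def ValidElemSpec (P : Presentation) (n b : ℕ) : Prop :=
  (b = 1 ∧ ∀ m ∈ listOfCode ℕ n, P.ValidElem m) ∨
    (b = 0 ∧ ∃ m ∈ listOfCode ℕ n, P.NotValidElem m)

/-- `b` is the answer to whether `n` represents an ideal of multisets: all ideals that occur in the
atoms are represented. -/
def ValidIdealSpec (P : Presentation) (n b : ℕ) : Prop :=
  (b = 1 ∧ ∀ m ∈ starNames (listOfCode (ℕ ⊕ List ℕ) n) ++ optNames (listOfCode (ℕ ⊕ List ℕ) n),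
      P.ValidIdeal m) ∨
    (b = 0 ∧ ∃ m ∈ starNames (listOfCode (ℕ ⊕ List ℕ) n) ++ optNames (listOfCode (ℕ ⊕ List ℕ) n),
      P.NotValidIdeal m)

/-- The criterion of `productIdeal_subset_iff`, on representations. -/
def ProductLE (P : Presentation) (c c' : List (ℕ ⊕ List ℕ)) : Prop :=
  (∀ i ∈ starNames c, ∃ j ∈ starNames c', P.IdealLE i j) ∧
    ∃ s ∈ assignments (optNames c) (optNames c'),
      (s.filterMap Prod.snd).Subperm (optNames c') ∧
      ∀ p ∈ s, (p.2 = none ∧ ∃ j ∈ starNames c', P.IdealLE p.1 j) ∨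
        ∃ j, p.2 = some j ∧ P.IdealLE p.1 j

/-- The negation of `ProductLE`, in terms of negative answers to queries, so that it is
semidecidable. -/
def NotProductLE (P : Presentation) (c c' : List (ℕ ⊕ List ℕ)) : Prop :=
  (∃ i ∈ starNames c, ∀ j ∈ starNames c', P.NotIdealLE i j) ∨
    ∀ s ∈ assignments (optNames c) (optNames c'),
      ¬ (s.filterMap Prod.snd).Subperm (optNames c') ∨
      ∃ p ∈ s, (p.2 = none ∧ ∀ j ∈ starNames c', P.NotIdealLE p.1 j) ∨
        ∃ j, p.2 = some j ∧ P.NotIdealLE p.1 j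

/-- `b` is the answer to whether the first of the ideals represented by the pair `n` is contained
in the second. -/
def IdealLESpec (P : Presentation) (n b : ℕ) : Prop :=
  (b = 1 ∧ ProductLE P (listOfCode _ n.unpair.1) (listOfCode _ n.unpair.2)) ∨
    (b = 0 ∧ NotProductLE P (listOfCode _ n.unpair.1) (listOfCode _ n.unpair.2))

/-- The principal ideal of `x₁ ⋯ xₙ` is represented by the product of the `↓xᵢ + ε`. -/
def PrincipalSpec (P : Presentation) (n k : ℕ) : Prop :=
  ∃ z : List (ℕ × ℕ), z.map Prod.fst = listOfCode ℕ n ∧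
    (∀ p ∈ z, p.2 ∈ P.algorithms.principal.eval p.1) ∧
    k = Encodable.encode (z.map fun p => (Sum.inl p.2 : ℕ ⊕ List ℕ))

/-- `b` is the answer to whether the first of the multisets represented by the pair `n` embeds into
the second: embedding is inclusion of the principal ideals. -/
def ElemLESpec (P : Presentation) (n b : ℕ) : Prop :=
  ∃ k k', PrincipalSpec P n.unpair.1 k ∧ PrincipalSpec P n.unpair.2 k' ∧
    IdealLESpec P (Nat.pair k k') b

section Semidecidable

variable {α : Type*} [Primcodable α] {P : α → Presentation} {n k : α → ℕ}
  {c c' : α → List (ℕ ⊕ List ℕ)}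

@[fun_prop]
theorem semidecidable_ProductLE (hP : Primrec P) (hc : Primrec c) (hc' : Primrec c') :
    Semidecidable fun a => ProductLE (P a) (c a) (c' a) := by unfold ProductLE; fun_prop

@[fun_prop]
theorem semidecidable_NotProductLE (hP : Primrec P) (hc : Primrec c) (hc' : Primrec c') :
    Semidecidable fun a => NotProductLE (P a) (c a) (c' a) := by unfold NotProductLE; fun_prop

@[fun_prop]
theorem semidecidable_IdealLESpec (hP : Primrec P) (hn : Primrec n) (hk : Primrec k) :
    Semidecidable fun a => IdealLESpec (P a) (n a) (k a) := by unfold IdealLESpec; fun_prop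

@[fun_prop]
theorem semidecidable_PrincipalSpec (hP : Primrec P) (hn : Primrec n) (hk : Primrec k) :
    Semidecidable fun a => PrincipalSpec (P a) (n a) (k a) := by unfold PrincipalSpec; fun_prop

end Semidecidable

section Correctness

variable {X : Type u} [Preorder X] {P : Presentation} {ρX : Naming X}
  {ρI : Naming (Order.Ideal X)}

theorem validElemSpec_iff (h : P.Decides ρX ρI) {n b : ℕ} :
    ValidElemSpec P n b ↔ b = truthValue (multisetNaming ρX n).isSome := by
  obtain ⟨l, rfl⟩ := exists_encode_eq (β := ℕ) n
  have hl := exists_multisetNaming_encode (ρX := ρX) (l := l)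
  rw [← Option.isSome_iff_exists] at hl
  rw [ValidElemSpec, listOfCode_encode]
  refine eq_truthValue_iff ?_ ?_
  · simp only [hl, h.validElem_iff]
  · simp only [hl, h.notValidElem_iff, not_forall, exists_prop]

theorem validIdealSpec_iff (h : P.Decides ρX ρI) {n b : ℕ} :
    ValidIdealSpec P n b ↔ b = truthValue (multisetIdealNaming ρI n).isSome := by
  obtain ⟨c, rfl⟩ := exists_encode_eq (β := ℕ ⊕ List ℕ) n
  have hc := exists_multisetIdealNaming_encode (ρI := ρI) (c := c)
  rw [← Option.isSome_iff_exists] at hc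
  rw [ValidIdealSpec, listOfCode_encode]
  refine eq_truthValue_iff ?_ ?_
  · simp only [hc, h.validIdeal_iff]
  · simp only [hc, h.notValidIdeal_iff, not_forall, exists_prop]

/-- An ideal is contained in a finite union of ideals iff it is contained in one of them. -/
theorem exists_idealLE_iff (h : P.Decides ρX ρI) {l : List ℕ} {D : Set X}
    (hl : RepresentsDown ρI l D) {i : ℕ} {I : Order.Ideal X} (hi : ρI i = some I) :
    (∃ j ∈ l, P.IdealLE i j) ↔ (I : Set X) ⊆ D := by
  rw [representsDown_iff] at hl
  constructor
  · rintro ⟨j, hj, hij⟩ x hx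
    obtain ⟨J, hJ⟩ := hl.1 j hj
    exact (hl.2 x).2 ⟨j, hj, J, hJ, (h.idealLE_iff hi hJ).1 hij hx⟩
  · intro hID
    obtain ⟨L, hL⟩ := exists_mapM_eq_some_iff.2 hl.1
    rw [mapM_eq_some_iff] at hL
    obtain ⟨J, hJ, hIJ⟩ := Order.Ideal.exists_subset_of_forall_exists (l := L) (I := I)
      fun x hx => (exists_mem_ideals_iff hL).2 ((hl.2 x).1 (hID hx))
    obtain ⟨j, hj, J', hJ', hIJ'⟩ := (exists_mem_ideals_iff hL
      (p := fun J => (I : Set X) ⊆ J)).1 ⟨J, hJ, hIJ⟩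
    exact ⟨j, hj, (h.idealLE_iff hi hJ').2 hIJ'⟩

theorem productLE_iff (h : P.Decides ρX ρI) {c c' : List (ℕ ⊕ List ℕ)} {Q Q' : List (Atom X)}
    (hc : c.mapM (atomOfCode ρI) = some Q) (hc' : c'.mapM (atomOfCode ρI) = some Q') :
    ProductLE P c c' ↔ (productIdeal Q : Set (FinMultiset X)) ⊆ productIdeal Q' := by
  obtain ⟨hs, ho⟩ := mapM_atomOfCode hc
  obtain ⟨hs', ho'⟩ := mapM_atomOfCode hc'
  rw [productIdeal_subset_iff, ProductLE, ← matches_iff_exists_assignment (R := P.IdealLE)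
    (D := fun i => ∃ j ∈ starNames c', P.IdealLE i j)]
  refine and_congr ?_ (Matches.congr_of_forall₂ ho ho'
    (fun i I hi => exists_idealLE_iff h hs' hi)
    fun i I j J hi hj => h.idealLE_iff hi hj)
  rw [representsDown_iff] at hs
  constructor
  · intro hle x hx
    obtain ⟨i, hi, I, hI, hxI⟩ := (hs.2 x).1 hx
    exact (exists_idealLE_iff h hs' hI).1 (hle i hi) hxI
  · intro hle i hi
    obtain ⟨I, hI⟩ := hs.1 i hi
    exact (exists_idealLE_iff h hs' hI).2 fun x hx => hle ((hs.2 x).2 ⟨i, hi, I, hI, hx⟩)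

theorem notProductLE_iff (h : P.Decides ρX ρI) {c c' : List (ℕ ⊕ List ℕ)} {Q Q' : List (Atom X)}
    (hc : c.mapM (atomOfCode ρI) = some Q) (hc' : c'.mapM (atomOfCode ρI) = some Q') :
    NotProductLE P c c' ↔ ¬ (productIdeal Q : Set (FinMultiset X)) ⊆ productIdeal Q' := by
  have hv := exists_mapM_atomOfCode.1 ⟨Q, hc⟩
  have hv' := exists_mapM_atomOfCode.1 ⟨Q', hc'⟩
  have hn : ∀ i ∈ starNames c ++ optNames c, ∀ j ∈ starNames c' ++ optNames c',
      P.NotIdealLE i j ↔ ¬ P.IdealLE i j := by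
    intro i hi j hj
    obtain ⟨I, hI⟩ := hv i hi
    obtain ⟨J, hJ⟩ := hv' j hj
    rw [h.notIdealLE_iff hI hJ, h.idealLE_iff hI hJ]
  have hstar : ∀ i ∈ starNames c ++ optNames c, (∀ j ∈ starNames c', P.NotIdealLE i j) ↔
      ¬ ∃ j ∈ starNames c', P.IdealLE i j := by
    intro i hi
    simp only [not_exists, not_and]
    exact forall₂_congr fun j hj => hn i hi j (List.mem_append_left _ hj)
  rw [← productLE_iff h hc hc', NotProductLE, ProductLE, not_and_or]
  refine or_congr ?_ ?_
  · simp only [not_forall, exists_prop]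
    exact exists_congr fun i => and_congr_right fun hi => hstar i (List.mem_append_left _ hi)
  · simp only [not_exists, not_and, not_forall, ← imp_iff_not_or]
    refine forall₂_congr fun s hs => imp_congr_right fun _ => ?_
    rw [mem_assignments] at hs
    simp only [exists_prop]
    refine exists_congr fun p => and_congr_right fun hp => ?_
    have hp1 : p.1 ∈ starNames c ++ optNames c :=
      List.mem_append_right _ (hs.1 ▸ List.mem_map_of_mem hp)
    obtain ⟨i, o⟩ := p
    cases o with
    | none => simpa using hstar i hp1
    | some j =>
      have hj : j ∈ optNames c' := hs.2 j (List.mem_filterMap.2 ⟨_, hp, rfl⟩)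
      simpa using hn i hp1 j (List.mem_append_right _ hj)

theorem idealLESpec_iff (h : P.Decides ρX ρI) {m n b : ℕ} {I J : Order.Ideal (FinMultiset X)}
    (hm : multisetIdealNaming ρI m = some I) (hn : multisetIdealNaming ρI n = some J) :
    IdealLESpec P (Nat.pair m n) b ↔ b = truthValue ((I : Set (FinMultiset X)) ⊆ J) := by
  obtain ⟨c, rfl⟩ := exists_encode_eq (β := ℕ ⊕ List ℕ) m
  obtain ⟨c', rfl⟩ := exists_encode_eq (β := ℕ ⊕ List ℕ) n
  obtain ⟨Q, hQ, rfl⟩ := multisetIdealNaming_encode.1 hm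
  obtain ⟨Q', hQ', rfl⟩ := multisetIdealNaming_encode.1 hn
  rw [IdealLESpec, Nat.unpair_pair, listOfCode_encode, listOfCode_encode]
  exact eq_truthValue_iff (productLE_iff h hQ hQ') (notProductLE_iff h hQ hQ')

theorem principalSpec_sound (h : P.Decides ρX ρI) {n k : ℕ} {M : FinMultiset X}
    (hn : multisetNaming ρX n = some M) (hk : PrincipalSpec P n k) :
    multisetIdealNaming ρI k = some (Order.Ideal.principal M) := by
  obtain ⟨l, rfl⟩ := exists_encode_eq (β := ℕ) n
  obtain ⟨w, hw, rfl⟩ := multisetNaming_encode.1 hn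
  obtain ⟨z, hz, hzp, rfl⟩ := hk
  rw [listOfCode_encode] at hz
  subst hz
  refine multisetIdealNaming_encode.2 ⟨_, mapM_eq_some_iff.2 ?_, productIdeal_map_principal w⟩
  rw [List.forall₂_map_left_iff] at hw
  rw [List.forall₂_map_left_iff, List.forall₂_map_right_iff]
  clear hn
  induction hw with
  | nil => exact .nil
  | @cons p x z w hpx _ ih =>
    rw [List.forall_mem_cons] at hzp
    obtain ⟨k, hk, hkx⟩ := h.principal p.1 x hpx
    have hpk := hzp.1
    rw [hk, Part.mem_some_iff] at hpk
    refine .cons ?_ (ih hzp.2)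
    simp [atomOfCode, hpk, hkx]

theorem exists_principalSpec (h : P.Decides ρX ρI) {n : ℕ} {M : FinMultiset X}
    (hn : multisetNaming ρX n = some M) : ∃ k, PrincipalSpec P n k := by
  obtain ⟨l, rfl⟩ := exists_encode_eq (β := ℕ) n
  have hl := exists_multisetNaming_encode.1 ⟨M, hn⟩
  have : ∃ z : List (ℕ × ℕ), z.map Prod.fst = l ∧
      ∀ p ∈ z, p.2 ∈ P.algorithms.principal.eval p.1 := by
    clear hn
    induction l with
    | nil => exact ⟨[], rfl, by simp⟩
    | cons n l ih =>
      rw [List.forall_mem_cons] at hl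
      obtain ⟨z, rfl, hz⟩ := ih hl.2
      obtain ⟨⟨x, hx⟩, -⟩ := hl
      obtain ⟨k, hk, -⟩ := h.principal n x hx
      exact ⟨(n, k) :: z, rfl, by simpa [hk] using hz⟩
  obtain ⟨z, hz, hzp⟩ := this
  exact ⟨_, z, by rw [listOfCode_encode, hz], hzp, rfl⟩

theorem elemLESpec_iff (h : P.Decides ρX ρI) {m n b : ℕ} {M N : FinMultiset X}
    (hm : multisetNaming ρX m = some M) (hn : multisetNaming ρX n = some N) :
    ElemLESpec P (Nat.pair m n) b ↔ b = truthValue (M ≤ N) := by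
  have key : ∀ k k', PrincipalSpec P m k → PrincipalSpec P n k' →
      (IdealLESpec P (Nat.pair k k') b ↔ b = truthValue (M ≤ N)) := by
    intro k k' hk hk'
    rw [idealLESpec_iff h (principalSpec_sound h hm hk) (principalSpec_sound h hn hk'),
      principal_subset_iff, Order.Ideal.mem_principal]
  rw [ElemLESpec, Nat.unpair_pair]
  constructor
  · rintro ⟨k, k', hk, hk', hb⟩
    exact (key k k' hk hk').1 hb
  · intro hb
    obtain ⟨k, hk⟩ := exists_principalSpec h hm
    obtain ⟨k', hk'⟩ := exists_principalSpec h hn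
    exact ⟨k, k', hk, hk', (key k k' hk hk').2 hb⟩

end Correctness

/-- Deciders, principal ideals, and the decompositions of the set of all multisets.  The other
algorithms of the result are placeholders. -/
theorem exists_deciders : ∃ G : Presentation → Presentation, Primrec G ∧
    ∀ (X : Type u) [Preorder X] (P : Presentation) (ρX : Naming X) (ρI : Naming (Order.Ideal X)),
      WellQuasiOrderedLE X → P.Decides ρX ρI →
      RepresentsDown ρI P.idealDecomposition Set.univ →
      (G P).Decides (multisetNaming ρX) (multisetIdealNaming ρI) ∧
      RepresentsDown (multisetIdealNaming ρI) (G P).idealDecomposition Set.univ ∧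
      RepresentsUp (multisetNaming ρX) (G P).filterDecomposition Set.univ := by
  obtain ⟨f₁, hf₁, h₁⟩ := Semidecidable.exists_codes (R := ValidElemSpec) (by
    unfold ValidElemSpec; fun_prop)
  obtain ⟨f₂, hf₂, h₂⟩ := Semidecidable.exists_codes (R := ValidIdealSpec) (by
    unfold ValidIdealSpec; fun_prop)
  obtain ⟨f₃, hf₃, h₃⟩ := Semidecidable.exists_codes (R := ElemLESpec) (by
    unfold ElemLESpec; fun_prop)
  obtain ⟨f₄, hf₄, h₄⟩ := Semidecidable.exists_codes (R := IdealLESpec) (by fun_prop)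
  obtain ⟨f₅, hf₅, h₅⟩ := Semidecidable.exists_codes (R := PrincipalSpec) (by fun_prop)
  -- The set of all multisets is `X*` up to permutation, and the filter of the empty multiset.
  refine ⟨fun P => ⟨⟨f₁ P, f₂ P, f₃ P, f₄ P, f₅ P, .zero, .zero, .zero, .zero⟩,
    [Encodable.encode [(Sum.inr P.idealDecomposition : ℕ ⊕ List ℕ)]],
    [Encodable.encode ([] : List ℕ)]⟩, by fun_prop, fun X _ P ρX ρI hX h hdec => ⟨?_, ?_, ?_⟩⟩
  · exact
      { elems := ⟨exists_multisetNaming_eq h.elems.1, fun n => by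
          obtain ⟨m, hm, hm'⟩ := h₁ P n ⟨_, (validElemSpec_iff h).2 rfl⟩
          rw [hm, (validElemSpec_iff h).1 hm']⟩
        ideals := ⟨exists_multisetIdealNaming_eq h.ideals.1, fun n => by
          obtain ⟨m, hm, hm'⟩ := h₂ P n ⟨_, (validIdealSpec_iff h).2 rfl⟩
          rw [hm, (validIdealSpec_iff h).1 hm']⟩
        elemLE := fun m n M N hM hN => by
          obtain ⟨b, hb, hb'⟩ := h₃ P (Nat.pair m n) ⟨_, (elemLESpec_iff h hM hN).2 rfl⟩
          rw [hb, (elemLESpec_iff h hM hN).1 hb']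
        idealLE := fun m n I J hI hJ => by
          obtain ⟨b, hb, hb'⟩ := h₄ P (Nat.pair m n) ⟨_, (idealLESpec_iff h hI hJ).2 rfl⟩
          rw [hb, (idealLESpec_iff h hI hJ).1 hb']
        principal := fun n M hM => by
          obtain ⟨k, hk, hk'⟩ := h₅ P n (exists_principalSpec h hM)
          exact ⟨k, hk, principalSpec_sound h hM hk'⟩ }
  · rw [representsDown_iff] at hdec ⊢
    obtain ⟨Q, hQ⟩ := exists_mapM_atomOfCode (ρI := ρI) (c := [.inr P.idealDecomposition]).2
      (by simpa [starNames, optNames] using hdec.1)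
    have hQ' := multisetIdealNaming_encode.2 ⟨Q, hQ, rfl⟩
    refine ⟨by simpa using ⟨_, hQ'⟩, fun M => ⟨fun _ => ⟨_, by simp, _, hQ', ?_⟩, fun _ => trivial⟩⟩
    rw [mem_productIdeal_iff]
    refine Matches.of_forall (fun x _ => ?_) _
    exact ((representsDown_iff.1 (mapM_atomOfCode hQ).1).2 x).2
      (by simpa [starNames] using (hdec.2 x).1 trivial)
  · rw [representsUp_iff]
    have hnil : multisetNaming ρX (Encodable.encode ([] : List ℕ)) =
        some (FinMultiset.ofList []) := multisetNaming_encode.2 ⟨[], .nil, rfl⟩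
    refine ⟨by simpa using ⟨_, hnil⟩, fun M => ⟨fun _ => ⟨_, by simp, _, hnil, ?_⟩,
      fun _ => trivial⟩⟩
    exact FinMultiset.le_iff.2 (Matches.zero_left _ _ _)

end MultisetPresentation

/-! ### Upper sets of multisets -/

namespace MultisetPresentation

open Presentation

/-- All lists over `B` of length at most `k`, obtained by filling `k` places, some of which may
stay empty. -/
def boundedLists (B : List ℕ) (k : ℕ) : List (List ℕ) :=
  ((List.range k).map fun _ => none :: B.map some).sections.map fun s => s.filterMap id

theorem mem_boundedLists {B : List ℕ} {k : ℕ} {l : List ℕ} :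
    l ∈ boundedLists B k ↔ l.length ≤ k ∧ ∀ b ∈ l, b ∈ B := by
  have hs : ∀ s : List (Option ℕ), s ∈ ((List.range k).map fun _ => none :: B.map some).sections ↔
      s.length = k ∧ ∀ o ∈ s, o ∈ none :: B.map some := by
    intro s
    rw [List.mem_sections, List.forall₂_map_right_iff, List.forall₂_iff_get]
    simp only [List.length_range, List.forall_mem_iff_getElem]
    constructor
    · rintro ⟨h, h'⟩
      exact ⟨h, fun i hi => h' i hi (by simpa [← h])⟩
    · rintro ⟨h, h'⟩
      exact ⟨h, fun i hi _ => h' i hi⟩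
  simp only [boundedLists, List.mem_map (l := List.sections _), hs]
  constructor
  · rintro ⟨s, ⟨rfl, hB⟩, rfl⟩
    refine ⟨List.length_filterMap_le _ _, fun b hb => ?_⟩
    obtain ⟨o, ho, rfl⟩ := List.mem_filterMap.1 hb
    simpa using hB _ ho
  · rintro ⟨hl, hB⟩
    refine ⟨l.map some ++ List.replicate (k - l.length) none, ⟨by simp; omega, ?_⟩, by simp⟩
    intro o ho
    rcases List.mem_append.1 ho with ho | ho
    · obtain ⟨b, hb, rfl⟩ := List.mem_map.1 ho
      simp [hB b hb]
    · simp [List.eq_of_mem_replicate ho]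

/-- A list of common upper bounds of two multisets represents the intersection of their filters
if it lies below all short common upper bounds with elements from a set that resolves the filters
of the elements of both.  Here `P` presents the base and `M` contains deciders for multisets. -/
def InterFilterSpec (P M : Presentation) (n k : ℕ) : Prop :=
  ∃ o : List ℕ, k = Encodable.encode o ∧
    (∀ K ∈ o, M.ValidElem K ∧ M.LE n.unpair.1 K ∧ M.LE n.unpair.2 K) ∧
    ∃ B, P.Resolves ((listOfCode ℕ n.unpair.1 ++ listOfCode ℕ n.unpair.2).map fun x => [x]) B ∧
      ∀ K ∈ boundedLists B
          ((listOfCode ℕ n.unpair.1).length + (listOfCode ℕ n.unpair.2).length),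
        (M.NotLE n.unpair.1 (Encodable.encode K) ∨ M.NotLE n.unpair.2 (Encodable.encode K)) ∨
          ∃ K' ∈ o, M.LE K' (Encodable.encode K)

/-- A list of multisets outside an ideal represents its complement if it lies below all short
multisets outside the ideal with elements from a set that resolves the ideals occurring in it. -/
def ComplIdealSpec (P M : Presentation) (n k : ℕ) : Prop :=
  ∃ o : List ℕ, k = Encodable.encode o ∧ (∀ K ∈ o, M.ValidElem K ∧ M.NotMem K n) ∧
    ∃ B, P.ResolvesIdeals
        (starNames (listOfCode (ℕ ⊕ List ℕ) n) ++ optNames (listOfCode (ℕ ⊕ List ℕ) n)) B ∧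
      ∀ K ∈ boundedLists B ((optNames (listOfCode (ℕ ⊕ List ℕ) n)).length + 1),
        M.Mem (Encodable.encode K) n ∨ ∃ K' ∈ o, M.LE K' (Encodable.encode K)

@[fun_prop]
theorem primrec_boundedLists {α : Type*} [Primcodable α] {B : α → List ℕ} {k : α → ℕ}
    (hB : Primrec B) (hk : Primrec k) : Primrec fun a => boundedLists (B a) (k a) := by
  unfold boundedLists
  fun_prop

/-- Rounding down the elements of a multiset yields a represented multiset over `B`. -/
theorem exists_boundedLists_map {X : Type u} {ρX : Naming X} {B : List ℕ} {f : X → X}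
    (hf : ∀ y, ∃ b ∈ B, ρX b = some (f y)) {S : Multiset X} {k : ℕ} (hS : Multiset.card S ≤ k) :
    ∃ K ∈ boundedLists B k,
      multisetNaming ρX (Encodable.encode K) = some (FinMultiset.ofMultiset (S.map f)) := by
  choose b hb hbf using hf
  refine ⟨S.toList.map b, mem_boundedLists.2 ⟨by simpa using hS, ?_⟩,
    multisetNaming_encode.2 ⟨S.toList.map f, ?_, ?_⟩⟩
  · intro c hc
    obtain ⟨y, -, rfl⟩ := List.mem_map.1 hc
    exact hb y
  · rw [List.forall₂_map_left_iff, List.forall₂_map_right_iff, List.forall₂_same]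
    exact fun y _ => hbf y
  · rw [FinMultiset.ofList, ← Multiset.map_coe, Multiset.coe_toList]
    rfl

theorem exists_multisetNaming_of_mem_boundedLists {X : Type u} {ρX : Naming X}
    {B : List ℕ} {k : ℕ} {K : List ℕ} (hB : ∀ b ∈ B, ∃ x, ρX b = some x)
    (hK : K ∈ boundedLists B k) :
    ∃ N, multisetNaming ρX (Encodable.encode K) = some N :=
  exists_multisetNaming_encode.2 fun b hb => hB b ((mem_boundedLists.1 hK).2 b hb)

section Correctness

variable {X : Type u} [Preorder X] {P M : Presentation} {ρX : Naming X}
  {ρI : Naming (Order.Ideal X)}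

theorem interFilterSpec_sound (h : P.ComputesUpperSets ρX ρI)
    (hM : M.Decides (multisetNaming ρX) (multisetIdealNaming ρI)) {m n k : ℕ}
    {V W : FinMultiset X} (hm : multisetNaming ρX m = some V) (hn : multisetNaming ρX n = some W)
    (hk : InterFilterSpec P M (Nat.pair m n) k) :
    ∃ l : List ℕ, k = Encodable.encode l ∧
      RepresentsUp (multisetNaming ρX) l (Set.Ici V ∩ Set.Ici W) := by
  obtain ⟨o, rfl, ho, B, hB, hcov⟩ := hk
  simp only [Nat.unpair_pair] at ho hB hcov
  have hval : ∀ K ∈ o, ∃ N, multisetNaming ρX K = some N := fun K hK =>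
    hM.validElem_iff.1 (ho K hK).1
  refine ⟨o, rfl, representsUp_iff.2 ⟨hval, fun N => ⟨fun ⟨hVN, hWN⟩ => ?_, ?_⟩⟩⟩
  · obtain ⟨l, rfl⟩ := exists_encode_eq (β := ℕ) m
    obtain ⟨l', rfl⟩ := exists_encode_eq (β := ℕ) n
    obtain ⟨v, hv, rfl⟩ := multisetNaming_encode.1 hm
    obtain ⟨w, hw, rfl⟩ := multisetNaming_encode.1 hn
    simp only [listOfCode_encode] at hB hcov
    have hvalid : ∀ d ∈ l ++ l', ∃ x, ρX d = some x := by
      intro d hd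
      rcases List.mem_append.1 hd with hd | hd
      exacts [exists_multisetNaming_encode.1 ⟨_, hm⟩ d hd,
        exists_multisetNaming_encode.1 ⟨_, hn⟩ d hd]
    choose b hb f hbf hf hres using h.resolves_sound
      (fun f hf d hd => by
        obtain ⟨c, hc, rfl⟩ := List.mem_map.1 hf
        rw [List.mem_singleton.1 hd]
        exact hvalid c hc) hB
    have hround : ∀ y, ∀ d ∈ l ++ l', ∀ x, ρX d = some x → x ≤ y → x ≤ f y := by
      intro y d hd x hx hxy
      obtain ⟨d', hd', z, hz, hzf⟩ := hres y [d] (List.mem_map_of_mem hd) ⟨d, by simp, x, hx, hxy⟩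
      rw [List.mem_singleton] at hd'
      rw [hd', hx, Option.some.injEq] at hz
      rwa [hz]
    have hname : ∀ {l : List ℕ} {v : List X}, List.Forall₂ (fun n x => ρX n = some x) l v →
        ∀ x ∈ v, ∃ d ∈ l, ρX d = some x := by
      intro l v hv x hx
      induction hv with
      | nil => simp at hx
      | cons hab _ ih =>
        rcases List.mem_cons.1 hx with rfl | hx
        · exact ⟨_, by simp, hab⟩
        · obtain ⟨d, hd, hdx⟩ := ih hx
          exact ⟨d, by simp [hd], hdx⟩
    obtain ⟨S, hS, hSN, hVS, hWS⟩ := exists_small_upper_bound hf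
      (fun y x hx hxy => by
        obtain ⟨d, hd, hdx⟩ := hname hv x hx
        exact hround y d (List.mem_append_left _ hd) x hdx hxy)
      (fun y x hx hxy => by
        obtain ⟨d, hd, hdx⟩ := hname hw x hx
        exact hround y d (List.mem_append_right _ hd) x hdx hxy) hVN hWN
    obtain ⟨K, hK, hKS⟩ := exists_boundedLists_map (fun y => ⟨b y, hb y, hbf y⟩)
      (k := l.length + l'.length) (S := S) (by
        simpa [hv.length_eq, hw.length_eq] using hS)
    rcases hcov K hK with (hle | hle) | ⟨K', hK', hle⟩
    · exact absurd hVS ((hM.notLE_iff hm hKS).1 hle)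
    · exact absurd hWS ((hM.notLE_iff hn hKS).1 hle)
    · obtain ⟨N', hN'⟩ := hval K' hK'
      exact ⟨K', hK', N', hN', ((hM.le_iff hN' hKS).1 hle).trans hSN⟩
  · rintro ⟨K, hK, N', hN', hle⟩
    exact ⟨((hM.le_iff hm hN').1 (ho K hK).2.1).trans hle,
      ((hM.le_iff hn hN').1 (ho K hK).2.2).trans hle⟩

theorem exists_interFilterSpec [WellQuasiOrderedLE (FinMultiset X)]
    (h : P.ComputesUpperSets ρX ρI)
    (hM : M.Decides (multisetNaming ρX) (multisetIdealNaming ρI)) {m n : ℕ}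
    {V W : FinMultiset X} (hm : multisetNaming ρX m = some V)
    (hn : multisetNaming ρX n = some W) : ∃ k, InterFilterSpec P M (Nat.pair m n) k := by
  obtain ⟨o, ho⟩ := exists_representsUp hM.elems.1 (UpperSet.Ici V ⊔ UpperSet.Ici W)
  rw [representsUp_iff] at ho
  obtain ⟨B, hBX, hB⟩ := h.exists_resolves
    (F := (listOfCode ℕ m ++ listOfCode ℕ n).map fun x => [x]) (by
      obtain ⟨l, rfl⟩ := exists_encode_eq (β := ℕ) m
      obtain ⟨l', rfl⟩ := exists_encode_eq (β := ℕ) n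
      have hl := exists_multisetNaming_encode.1 ⟨_, hm⟩
      have hl' := exists_multisetNaming_encode.1 ⟨_, hn⟩
      intro f hf d hd
      simp only [listOfCode_encode] at hf
      obtain ⟨c, hc, rfl⟩ := List.mem_map.1 hf
      rw [List.mem_singleton.1 hd]
      exact (List.mem_append.1 hc).elim (hl c) (hl' c))
  refine ⟨_, o, rfl, ?_, B, by simpa using hB, ?_⟩
  · simp only [Nat.unpair_pair]
    intro K hK
    obtain ⟨N, hN⟩ := ho.1 K hK
    have hN' := (ho.2 N).2 ⟨K, hK, N, hN, le_rfl⟩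
    exact ⟨hM.validElem_iff.2 ⟨N, hN⟩, (hM.le_iff hm hN).2 hN'.1, (hM.le_iff hn hN).2 hN'.2⟩
  · simp only [Nat.unpair_pair]
    intro K hK
    obtain ⟨N, hN⟩ := exists_multisetNaming_of_mem_boundedLists hBX hK
    by_cases hV : V ≤ N
    · by_cases hW : W ≤ N
      · obtain ⟨K', hK', N', hN', hle⟩ := (ho.2 N).1 ⟨hV, hW⟩
        exact .inr ⟨K', hK', (hM.le_iff hN' hN).2 hle⟩
      · exact .inl (.inr ((hM.notLE_iff hn hN).2 hW))
    · exact .inl (.inl ((hM.notLE_iff hm hN).2 hV))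

theorem complIdealSpec_sound (h : P.ComputesUpperSets ρX ρI)
    (hM : M.Decides (multisetNaming ρX) (multisetIdealNaming ρI)) {n k : ℕ}
    {J : Order.Ideal (FinMultiset X)} (hn : multisetIdealNaming ρI n = some J)
    (hk : ComplIdealSpec P M n k) :
    ∃ l : List ℕ, k = Encodable.encode l ∧
      RepresentsUp (multisetNaming ρX) l (J : Set (FinMultiset X))ᶜ := by
  obtain ⟨o, rfl, ho, B, hB, hcov⟩ := hk
  have hval : ∀ K ∈ o, ∃ N, multisetNaming ρX K = some N := fun K hK =>
    hM.validElem_iff.1 (ho K hK).1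
  refine ⟨o, rfl, representsUp_iff.2 ⟨hval, fun N => ⟨fun hNJ => ?_, ?_⟩⟩⟩
  · obtain ⟨c, rfl⟩ := exists_encode_eq (β := ℕ ⊕ List ℕ) n
    obtain ⟨Q, hQ, rfl⟩ := multisetIdealNaming_encode.1 hn
    obtain ⟨hstar, hopt⟩ := mapM_atomOfCode hQ
    rw [representsDown_iff] at hstar
    rw [listOfCode_encode] at hB hcov
    have hvalid := exists_mapM_atomOfCode.1 ⟨Q, hQ⟩
    choose b hb f hbf hf hres using h.resolvesIdeals_sound hvalid hB
    obtain ⟨S, hS, hSN, hSJ⟩ := exists_small_notMem_productIdeal (P := Q) hf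
      (fun y hy => by
        obtain ⟨i, hi, I, hI, hyI⟩ := (hstar.2 _).1 hy
        exact (hstar.2 y).2 ⟨i, hi, I, hI, hres y i (List.mem_append_left _ hi) I hI hyI⟩)
      (fun y I hI hyI => by
        obtain ⟨i, hi, I', hI', rfl⟩ := (exists_mem_ideals_iff hopt (p := fun I' => I = I')).1
          ⟨I, hI, rfl⟩
        exact hres y i (List.mem_append_right _ hi) _ hI' hyI) hNJ
    obtain ⟨K, hK, hKS⟩ := exists_boundedLists_map (fun y => ⟨b y, hb y, hbf y⟩)
      (k := (optNames c).length + 1) (S := S) (by rwa [hopt.length_eq])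
    rcases hcov K hK with hmem | ⟨K', hK', hle⟩
    · exact absurd ((hM.mem_iff hKS hn).1 hmem) hSJ
    · obtain ⟨N', hN'⟩ := hval K' hK'
      exact ⟨K', hK', N', hN', ((hM.le_iff hN' hKS).1 hle).trans hSN⟩
  · rintro ⟨K, hK, N', hN', hle⟩ hNJ
    exact (hM.notMem_iff hN' hn).1 (ho K hK).2 (J.lower hle hNJ)

theorem exists_complIdealSpec [WellQuasiOrderedLE (FinMultiset X)]
    (h : P.ComputesUpperSets ρX ρI)
    (hM : M.Decides (multisetNaming ρX) (multisetIdealNaming ρI)) {n : ℕ}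
    {J : Order.Ideal (FinMultiset X)} (hn : multisetIdealNaming ρI n = some J) :
    ∃ k, ComplIdealSpec P M n k := by
  obtain ⟨o, ho⟩ := exists_representsUp hM.elems.1 J.toLowerSet.compl
  rw [representsUp_iff] at ho
  obtain ⟨B, hBX, hB⟩ := h.exists_resolvesIdeals (L :=
    starNames (listOfCode (ℕ ⊕ List ℕ) n) ++ optNames (listOfCode (ℕ ⊕ List ℕ) n)) (by
      obtain ⟨c, rfl⟩ := exists_encode_eq (β := ℕ ⊕ List ℕ) n
      rw [listOfCode_encode]
      exact exists_multisetIdealNaming_encode.1 ⟨J, hn⟩)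
  refine ⟨_, o, rfl, fun K hK => ?_, B, hB, fun K hK => ?_⟩
  · obtain ⟨N, hN⟩ := ho.1 K hK
    exact ⟨hM.validElem_iff.2 ⟨N, hN⟩,
      (hM.notMem_iff hN hn).2 ((ho.2 N).2 ⟨K, hK, N, hN, le_rfl⟩)⟩
  · obtain ⟨N, hN⟩ := exists_multisetNaming_of_mem_boundedLists hBX hK
    by_cases hNJ : N ∈ J
    · exact .inl ((hM.mem_iff hN hn).2 hNJ)
    · obtain ⟨K', hK', N', hN', hle⟩ := (ho.2 N).1 hNJ
      exact .inr ⟨K', hK', (hM.le_iff hN' hN).2 hle⟩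

end Correctness

/-- A presentation of the finite multisets is uniformly computable from a presentation of the
base. -/
theorem exists_presentation : ∃ F : Presentation → Presentation, Primrec F ∧
    ∀ (X : Type u) [Preorder X] (ρX : Naming X) (ρI : Naming (Order.Ideal X)) (P : Presentation),
      P.Presents ρX ρI → (F P).Presents (multisetNaming ρX) (multisetIdealNaming ρI) := by
  obtain ⟨D, hD, hD'⟩ := exists_deciders
  obtain ⟨C, hC, hC'⟩ := exists_completion
  obtain ⟨f, hf, hf'⟩ := Semidecidable.exists_codes
    (R := fun p : Presentation × Presentation => InterFilterSpec p.1 p.2) (by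
      unfold InterFilterSpec; fun_prop)
  obtain ⟨g, hg, hg'⟩ := Semidecidable.exists_codes
    (R := fun p : Presentation × Presentation => ComplIdealSpec p.1 p.2) (by
      unfold ComplIdealSpec; fun_prop)
  -- The operations that return lower sets are placeholders, to be replaced by `C`.
  refine ⟨fun P => C ⟨⟨(D P).algorithms.validElem, (D P).algorithms.validIdeal,
    (D P).algorithms.elemLE, (D P).algorithms.idealLE, (D P).algorithms.principal, .zero,
    f (P, D P), g (P, D P), .zero⟩, (D P).idealDecomposition, (D P).filterDecomposition⟩,
    by fun_prop, fun X _ ρX ρI P hP => ?_⟩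
  have := hP.wqo
  have hwqo : WellQuasiOrderedLE (FinMultiset X) := FinMultiset.wellQuasiOrderedLE hP.wqo
  have h := hP.computesUpperSets
  obtain ⟨hM, hdown, hup⟩ := hD' X P ρX ρI hP.wqo h.toDecides hP.ideals
  exact hC' _ _ _ _ hwqo
    { elems := hM.elems
      ideals := hM.ideals
      elemLE := hM.elemLE
      idealLE := hM.idealLE
      principal := hM.principal
      interFilter := fun m n V W hm hn => by
        obtain ⟨k, hk, hk'⟩ := hf' (P, D P) _ (exists_interFilterSpec h hM hm hn)
        obtain ⟨l, rfl, hl⟩ := interFilterSpec_sound h hM hm hn hk'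
        exact ⟨l, hk, hl⟩
      complIdeal := fun n J hn => by
        obtain ⟨k, hk, hk'⟩ := hg' (P, D P) _ (exists_complIdealSpec h hM hn)
        obtain ⟨l, rfl, hl⟩ := complIdealSpec_sound h hM hn hk'
        exact ⟨l, hk, hl⟩
      filters := hup } hdown

end MultisetPresentation

/-- Ideal effectiveness provides a presentation, since in a well-quasi-ordering the decompositions
of the whole set exist. -/
theorem IdeallyEffective.exists_presents {X : Type u} [Preorder X] {ρX : Naming X}
    {ρI : Naming (Order.Ideal X)} (h : IdeallyEffective ρX ρI) :
    ∃ P : Presentation, P.Presents ρX ρI := by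
  obtain ⟨hX, A, hA⟩ := h
  obtain ⟨l, hl⟩ := Presentation.exists_representsDown hA.ideals.1 (⊤ : LowerSet X)
  obtain ⟨m, hm⟩ := Presentation.exists_representsUp hA.elems.1 (⊥ : UpperSet X)
  exact ⟨⟨A, l, m⟩, hX, hA, hl, hm⟩

theorem multisetConstructor_isIdeallyEffective :
    multisetConstructor.{u}.IsIdeallyEffective := by
  obtain ⟨F, hF, hF'⟩ := MultisetPresentation.exists_presentation
  refine ⟨fun X _ hX => FinMultiset.wellQuasiOrderedLE hX, fun X _ ρX ρI h => ?_, F,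
    hF.to_comp, hF'⟩
  obtain ⟨P, hP⟩ := h.exists_presents
  have := hF' X ρX ρI P hP
  exact ⟨this.wqo, _, this.correct⟩

theorem mainTheorem8 :
    multisetConstructor.{u}.IsIdeallyEffective ∧
    (∀ (X : Type u) [Preorder X] (u v : List X),
      (FinMultiset.ofList u ≤ FinMultiset.ofList v ↔ ∃ w, u.Perm w ∧ HigmanLE w v) ∧
      (FinMultiset.ofList u ≤ FinMultiset.ofList v ↔ ∃ w, HigmanLE u w ∧ w.Perm v)) ∧
    (∀ (X : Type u) [Preorder X] [WellQuasiOrderedLE X] (P : List (Atom X)),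
      permClosure (productLang P) =
        ⋃ σ : Equiv.Perm (Fin (idealFactors P).length), productLang (permutedProduct P σ)) :=
  ⟨multisetConstructor_isIdeallyEffective,
    fun _ _ _ _ => ⟨FinMultiset.ofList_le_iff_perm_higman, FinMultiset.ofList_le_iff_higman_perm⟩,
    fun _ _ _ P => permClosure_productLang P⟩
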